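/- For $N\ge 0$ let $\mathbb T^N=\mathbb R^N/\mathbb Z^N$, and let $\mathcal H$ be a finitely generated nilpotent group (abelian groups are allowed). A homomorphism $\rho:\mathcal H\to GL(N,\mathbb Z)$ induces an action of $\mathcal H$ on $\mathbb T^N$ by automorphisms. Call the action - *genuinely partially hyperbolic* if it is ergodic with respect to Lebesgue measure, but no element $\rho(h)$, $h\in\mathcal H$, is hyperbolic, i.e. each $\rho(h)$ has a complex eigenvalue of absolute value $1$; - *higher rank* if there are $A,B\in\rho(\mathcal H)$ such that $A^{k_1}B^{k_2}$ acts ergodically on $\mathbb T^N$ for every $(k_1,k_2)\in\mathbb Z^2\setminus\{0\}$; - *irreducible* if $\{0\}$ and $\mathbb Q^N$ are the only $\rho(\mathcal H)$-invariant subspaces of $\mathbb Q^N$, and *reducible* otherwise. **Theorem 3.** 1. For every even $N\ge 6$ there is an irreducible, genuinely partially hyperbolic, higher rank action on $\mathbb T^N$ of some finitely generated nilpotent group $\mathcal H$, given by an embedding $\rho:\mathcal H\to GL(N,\mathbb Z)$. 2. For every odd $N\ge 9$ there is a genuinely partially hyperbolic, higher rank action on $\mathbb T^N$ of some finitely generated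 nilpotent group $\mathcal H$, given by an embedding $\rho:\mathcal H\to GL(N,\mathbb Z)$; and every genuinely partially hyperbolic, higher rank action on $\mathbb T^N$ of a finitely generated nilpotent group by automorphisms is reducible. 3. If $N\le 5$ or $N=7$, no action of a finitely generated nilpotent group on $\mathbb T^N$ by automorphisms is both genuinely partially hyperbolic and higher rank. -/

import Mathlib

open MeasureTheory
open scoped Matrix

universe u

/-- The map of the torus `𝕋ᴺ = (ℝ/ℤ)ᴺ` induced by an integer `N × N` matrix. -/
def toralMap {N : ℕ} (A : Matrix (Fin N) (Fin N) ℤ) (x : UnitAddTorus (Fin N)) :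
    UnitAddTorus (Fin N) :=
  fun i => ∑ j, A i j • x j

theorem toralMap_one {N : ℕ} (x : UnitAddTorus (Fin N)) :
    toralMap (1 : Matrix (Fin N) (Fin N) ℤ) x = x := by
  funext i
  simp [toralMap, Matrix.one_apply, ite_smul]

theorem toralMap_mul {N : ℕ} (A B : Matrix (Fin N) (Fin N) ℤ) (x : UnitAddTorus (Fin N)) :
    toralMap (A * B) x = toralMap A (toralMap B x) := by
  funext i
  simp only [toralMap, Matrix.mul_apply, Finset.sum_smul, Finset.smul_sum, mul_smul]
  exact Finset.sum_comm

/-- The action of a group `H` on `𝕋ᴺ` by automorphisms induced by a homomorphism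
`ρ : H → GL(N, ℤ)`. -/
abbrev toralAction {H : Type*} [Group H] {N : ℕ}
    (ρ : H →* Matrix.GeneralLinearGroup (Fin N) ℤ) :
    MulAction H (UnitAddTorus (Fin N)) where
  smul h x := toralMap (ρ h).val x
  one_smul x := by
    change toralMap (ρ 1).val x = x
    rw [map_one, Units.val_one, toralMap_one]
  mul_smul g h x := by
    change toralMap (ρ (g * h)).val x = toralMap (ρ g).val (toralMap (ρ h).val x)
    rw [map_mul, Units.val_mul, toralMap_mul]

/-- The toral automorphism given by `A ∈ GL(N, ℤ)` is ergodic with respect to Lebesgue (Haar)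
measure on `𝕋ᴺ`. -/
def IsErgodicElement {N : ℕ} (A : Matrix.GeneralLinearGroup (Fin N) ℤ) : Prop :=
  Ergodic (toralMap A.val) (volume : Measure (UnitAddTorus (Fin N)))

/-- The toral automorphism given by `A ∈ GL(N, ℤ)` is hyperbolic (Anosov): no complex eigenvalue
of `A` has absolute value one. -/
def IsHyperbolicElement {N : ℕ} (A : Matrix.GeneralLinearGroup (Fin N) ℤ) : Prop :=
  ∀ z ∈ spectrum ℂ (A.val.map (Int.cast : ℤ → ℂ)), ‖z‖ ≠ 1

/-- The action on `𝕋ᴺ` induced by `ρ` is ergodic with respect to Lebesgue (Haar) measure. -/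
def IsErgodicAction {H : Type*} [Group H] {N : ℕ}
    (ρ : H →* Matrix.GeneralLinearGroup (Fin N) ℤ) : Prop :=
  letI := toralAction ρ
  ErgodicSMul H (UnitAddTorus (Fin N)) volume

/-- The action is ergodic with respect to Lebesgue measure, but none of its elements is
hyperbolic. -/
def IsGenuinelyPartiallyHyperbolic {H : Type*} [Group H] {N : ℕ}
    (ρ : H →* Matrix.GeneralLinearGroup (Fin N) ℤ) : Prop :=
  IsErgodicAction ρ ∧ ∀ h : H, ¬ IsHyperbolicElement (ρ h)

/-- The action contains two elements `A`, `B` such that `A ^ k₁ * B ^ k₂` is ergodic for every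
nonzero `(k₁, k₂) ∈ ℤ²`. -/
def IsHigherRank {H : Type*} [Group H] {N : ℕ}
    (ρ : H →* Matrix.GeneralLinearGroup (Fin N) ℤ) : Prop :=
  ∃ A ∈ ρ.range, ∃ B ∈ ρ.range, ∀ k : ℤ × ℤ, k ≠ 0 → IsErgodicElement (A ^ k.1 * B ^ k.2)

/-- The action is irreducible: the only rational subspaces invariant under it are the two
trivial ones. -/
def IsIrreducibleAction {H : Type*} [Group H] {N : ℕ}
    (ρ : H →* Matrix.GeneralLinearGroup (Fin N) ℤ) : Prop :=
  ∀ W : Submodule ℚ (Fin N → ℚ),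
    (∀ h : H, ∀ w ∈ W, (ρ h).val.map (Int.cast : ℤ → ℚ) *ᵥ w ∈ W) → W = ⊥ ∨ W = ⊤

/-! Nonexistence: cut `ℚ^N` into irreducible factors of the nilpotent group. On each factor, Schur's
lemma makes the central operators generate a field, and a determinant over it shows that central
commutators are roots of unity. Nilpotency then puts a fixed power of every element into the field
(`IsIrreducibleRep.exists_field_of_isNilpotent`). So powers of `A` and `B` act on each factor as
units `a`, `b` of a number field `K`, independent by higher rank. Products of these powers always
have an eigenvalue of modulus one, and a pigeonhole finds one embedding `φ` with `|φ a| = |φ b| =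
1`. Then `[K : ℚ]` is even, and it exceeds 4, since otherwise the logarithms have a single real
parameter, too few for two independent units. Hence some factor has dimension divisible by an even
number at least 6 (`exists_even_dvd_of_irreducibleRep_factors`). This excludes irreducibility for
odd `N`, and everything for `N ≤ 5`; for `N = 7` an eigenvalue `±1` is left over, so `A ^ 2` is not
ergodic.

Existence: for `N = 2j + 4` adjoin a root `θ` of `X^N - 6 X^(2j) + 2`, with involution `τ : θ ↦ -θ`.
At a purely imaginary root `τ` becomes complex conjugation, so each `ε / τ ε` has modulus one there.
Units `ε` dominant at two real embeddings give independent quotients, which act on `𝓞 K` by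
multiplication. For odd `N` a cubic field is added as a direct factor. -/

open scoped commutatorElement

/-! ### Fourier series and ergodicity of toral automorphisms -/

-- The variable `μ` lets `subst` carry the Fourier basis over to `volume`, which is only
-- propositionally equal to the product of Haar measures.
open UnitAddTorus in
theorem exists_hilbertBasis_mFourier {N : ℕ} (μ : Measure (UnitAddTorus (Fin N)))
    (hμ : μ = Measure.pi fun _ => AddCircle.haarAddCircle) :
    ∃ b : HilbertBasis (Fin N → ℤ) ℂ (Lp ℂ 2 μ), (∀ n, b n =ᵐ[μ] mFourier n) ∧
      ∀ f n, b.repr f n = ∫ t, mFourier (-n) t * f t ∂μ := by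
  subst hμ
  refine ⟨mFourierBasis, fun n => ?_, fun f n => mFourierBasis_repr f n⟩
  rw [coe_mFourierBasis]
  exact coeFn_mFourierLp 2 n

theorem volume_unitAddTorus (N : ℕ) : (volume : Measure (UnitAddTorus (Fin N))) =
    Measure.pi fun _ => AddCircle.haarAddCircle := by
  have h : (volume : Measure UnitAddCircle) = AddCircle.haarAddCircle := by
    rw [AddCircle.volume_eq_smul_haarAddCircle]
    simp
  change Measure.pi (fun _ => volume) = _
  rw [h]

instance isProbabilityMeasure_unitAddTorus (N : ℕ) :
    IsProbabilityMeasure (volume : Measure (UnitAddTorus (Fin N))) := by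
  rw [volume_unitAddTorus]; infer_instance

instance isAddHaarMeasure_unitAddTorus (N : ℕ) :
    (volume : Measure (UnitAddTorus (Fin N))).IsAddHaarMeasure :=
  inferInstanceAs (Measure.pi fun _ : Fin N => (volume : Measure UnitAddCircle)).IsAddHaarMeasure

/-- The toral map of an integer matrix as a group endomorphism. -/
def toralHom {N : ℕ} (A : Matrix (Fin N) (Fin N) ℤ) :
    UnitAddTorus (Fin N) →+ UnitAddTorus (Fin N) where
  toFun := toralMap A
  map_zero' := by ext; simp [toralMap]
  map_add' x y := by ext; simp [toralMap, Finset.sum_add_distrib]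

theorem continuous_toralMap {N : ℕ} (A : Matrix (Fin N) (Fin N) ℤ) :
    Continuous (toralMap A) := by
  unfold toralMap
  fun_prop

theorem measurePreserving_toralMap {N : ℕ} (A : Matrix.GeneralLinearGroup (Fin N) ℤ) :
    MeasurePreserving (toralMap A.val) (volume : Measure (UnitAddTorus (Fin N))) volume := by
  refine (toralHom A.val).measurePreserving (continuous_toralMap _) (fun y => ?_) rfl
  refine ⟨toralMap (A⁻¹).val y, ?_⟩
  change toralMap A.val (toralMap (A⁻¹).val y) = y
  rw [← toralMap_mul, ← Units.val_mul, mul_inv_cancel, Units.val_one, toralMap_one]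

open UnitAddTorus in
theorem mFourier_toralMap {N : ℕ} (A : Matrix (Fin N) (Fin N) ℤ) (n : Fin N → ℤ)
    (x : UnitAddTorus (Fin N)) : mFourier n (toralMap A x) = mFourier (n ᵥ* A) x := by
  have key : ∀ (n : Fin N → ℤ) (x : UnitAddTorus (Fin N)),
      mFourier n x = ((AddCircle.toCircle (∑ i, n i • x i) : Circle) : ℂ) := by
    intro n x
    simp only [mFourier, ContinuousMap.coe_mk, fourier_apply]
    induction (Finset.univ : Finset (Fin N)) using Finset.cons_induction with
    | empty => simp
    | cons a s ha ih =>
      rw [Finset.prod_cons, Finset.sum_cons, ih, AddCircle.toCircle_add, Circle.coe_mul]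
  rw [key, key]
  congr 2
  simp only [toralMap, Finset.smul_sum, Matrix.vecMul, dotProduct, Finset.sum_smul, mul_smul]
  exact Finset.sum_comm

open UnitAddTorus in
theorem integral_mFourier {N : ℕ} {n : Fin N → ℤ} (hn : n ≠ 0) :
    ∫ t, mFourier n t ∂(volume : Measure (UnitAddTorus (Fin N))) = 0 := by
  obtain ⟨b, hb, hr⟩ := exists_hilbertBasis_mFourier _ (volume_unitAddTorus N)
  have h := hr (b 0) (-n)
  rw [HilbertBasis.repr_self, lp.single_apply_ne _ _ _ (by simpa using hn)] at h
  rw [h]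
  refine integral_congr_ae ?_
  filter_upwards [hb 0] with t ht
  simp [ht, mFourier_zero]

-- A singular `A - 1` fixes a nonzero integer row vector, whose character is invariant. Ergodicity
-- would make it constant, but it has modulus one and integral zero.
open UnitAddTorus in
theorem Ergodic.det_sub_one_ne_zero {N : ℕ} {A : Matrix (Fin N) (Fin N) ℤ}
    (hA : Ergodic (toralMap A) (volume : Measure (UnitAddTorus (Fin N)))) :
    (A - 1).det ≠ 0 := by
  intro hdet
  obtain ⟨n, hn, hnA⟩ := Matrix.exists_vecMul_eq_zero_iff.mpr hdet
  have hfix : n ᵥ* A = n := by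
    rw [Matrix.vecMul_sub, Matrix.vecMul_one, sub_eq_zero] at hnA
    exact hnA
  obtain ⟨c, hc⟩ := hA.ae_eq_const_of_ae_eq_comp_ae (g := fun x => mFourier n x)
    (mFourier n).continuous.aestronglyMeasurable
    (Filter.Eventually.of_forall fun x => by simp [mFourier_toralMap, hfix])
  have h0 := integral_mFourier hn
  rw [integral_congr_ae hc] at h0
  simp only [Function.const_apply, integral_const, probReal_univ, one_smul] at h0
  obtain ⟨x, hx⟩ := hc.exists
  have : ‖mFourier n x‖ = 1 := by
    simp only [mFourier, ContinuousMap.coe_mk, fourier_apply, norm_prod]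
    exact Finset.prod_eq_one fun i _ => Circle.norm_coe _
  replace hx : mFourier n x = c := hx
  rw [hx, h0, norm_zero] at this
  exact zero_ne_one this

-- The Fourier coefficients of an invariant indicator are constant along orbits `n ᵥ* A ^ k`. For `n
-- ≠ 0` these orbits are infinite, so square summability leaves only the zeroth coefficient.
open UnitAddTorus in
theorem ergodic_toralMap {N : ℕ} {A : Matrix.GeneralLinearGroup (Fin N) ℤ}
    (hA : ∀ k : ℕ, 0 < k → (A.val ^ k - 1).det ≠ 0) :
    Ergodic (toralMap A.val) (volume : Measure (UnitAddTorus (Fin N))) := by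
  have hmp := measurePreserving_toralMap A
  refine ⟨hmp, ⟨fun s hs hinv => ?_⟩⟩
  obtain ⟨b, hb, hr⟩ := exists_hilbertBasis_mFourier _ (volume_unitAddTorus N)
  set f : Lp ℂ 2 (volume : Measure (UnitAddTorus (Fin N))) :=
    indicatorConstLp 2 hs (measure_ne_top _ _) 1 with hf
  have hfs : f =ᵐ[volume] s.indicator fun _ => (1 : ℂ) := indicatorConstLp_coeFn
  have hcoef : ∀ n, b.repr f n = ∫ t, mFourier (-n) t * s.indicator (fun _ => (1 : ℂ)) t := by
    intro n
    rw [hr]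
    refine integral_congr_ae ?_
    filter_upwards [hfs] with t ht
    rw [ht]
  have hstep : ∀ n, b.repr f (n ᵥ* A.val) = b.repr f n := by
    intro n
    have hmeas : AEStronglyMeasurable
        (fun t => mFourier (-n) t * s.indicator (fun _ => (1 : ℂ)) t)
        (Measure.map (toralMap A.val) volume) :=
      (mFourier (-n)).continuous.aestronglyMeasurable.mul
        (stronglyMeasurable_const.indicator hs).aestronglyMeasurable
    rw [hcoef, hcoef, ← hmp.map_eq, integral_map hmp.measurable.aemeasurable hmeas, hmp.map_eq]
    refine integral_congr_ae (Filter.Eventually.of_forall fun t => ?_)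
    have hind : s.indicator (fun _ => (1 : ℂ)) (toralMap A.val t) = s.indicator (fun _ => 1) t := by
      have : toralMap A.val t ∈ s ↔ t ∈ s := by
        conv_rhs => rw [← hinv]
        rfl
      by_cases h : t ∈ s <;> simp [this, h]
    simp only [hind, mFourier_toralMap, Matrix.neg_vecMul]
  have hiter : ∀ (n) (k : ℕ), b.repr f (n ᵥ* A.val ^ k) = b.repr f n := by
    intro n k
    induction k with
    | zero => simp
    | succ k ih => rw [pow_succ, ← Matrix.vecMul_vecMul, hstep, ih]
  have hzero : ∀ n, n ≠ 0 → b.repr f n = 0 := by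
    intro n hn
    have hinj : Function.Injective fun k : ℕ => n ᵥ* A.val ^ k := by
      have aux : ∀ i k : ℕ, 0 < k → n ᵥ* A.val ^ i ≠ n ᵥ* A.val ^ (i + k) := by
        intro i k hk h
        refine hA k hk (Matrix.exists_vecMul_eq_zero_iff.mp ⟨n ᵥ* A.val ^ i, ?_, ?_⟩)
        · intro h0
          apply hn
          have h1 := congrArg (· ᵥ* ((A⁻¹).val ^ i)) h0
          simpa [Matrix.vecMul_vecMul, ← Units.val_pow_eq_pow_val, ← Units.val_mul] using h1
        · rw [Matrix.vecMul_sub, Matrix.vecMul_one, Matrix.vecMul_vecMul, ← pow_add, ← h, sub_self]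
      intro i j hij
      by_contra hne
      rcases Nat.lt_or_gt_of_ne hne with h | h
      · exact aux i (j - i) (by omega) (by rw [Nat.add_sub_cancel' h.le]; exact hij)
      · exact aux j (i - j) (by omega) (by rw [Nat.add_sub_cancel' h.le]; exact hij.symm)
    have hsum : Summable fun n => ‖b.repr f n‖ ^ (2 : ℝ) := by
      simpa using (lp.memℓp (b.repr f)).summable (by simp)
    have h2 := (hsum.comp_injective hinj).tendsto_atTop_zero
    simp only [Function.comp_def, hiter] at h2
    have h3 := tendsto_nhds_unique h2 tendsto_const_nhds
    by_contra h4
    have : 0 < ‖b.repr f n‖ ^ (2 : ℝ) := by positivity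
    rw [h3] at this
    exact this.ne rfl
  have hfeq : f = b.repr f 0 • b 0 := by
    apply b.repr.injective
    ext n
    by_cases hn : n = 0
    · subst hn
      simp [HilbertBasis.repr_self]
    · rw [hzero n hn, map_smul, HilbertBasis.repr_self, lp.coeFn_smul, Pi.smul_apply,
        lp.single_apply_ne _ _ _ hn, smul_zero]
  have hae : ∀ᵐ t ∂(volume : Measure (UnitAddTorus (Fin N))),
      s.indicator (fun _ => (1 : ℂ)) t = b.repr f 0 := by
    have h5 := Lp.coeFn_smul (b.repr f 0) (b 0)
    rw [← hfeq] at h5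
    filter_upwards [hfs, h5, hb 0] with t h1 h2 h3
    rw [← h1, h2, Pi.smul_apply, h3, mFourier_zero]
    simp
  rw [Filter.eventuallyConst_set]
  by_cases hc : b.repr f 0 = 1
  · left
    filter_upwards [hae] with t ht
    by_contra hts
    rw [Set.indicator_of_notMem hts, hc] at ht
    exact zero_ne_one ht
  · right
    filter_upwards [hae] with t ht hts
    rw [Set.indicator_of_mem hts] at ht
    exact hc ht.symm

theorem isErgodicAction_of_isErgodicElement {H : Type*} [Group H] {N : ℕ}
    (ρ : H →* Matrix.GeneralLinearGroup (Fin N) ℤ) {h : H} (hh : IsErgodicElement (ρ h)) :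
    IsErgodicAction ρ := by
  let := toralAction ρ
  refine @ErgodicSMul.mk _ _ _ _ _ ⟨fun g s hs => ?_⟩ fun {s} hs hinv => ?_
  · exact (measurePreserving_toralMap (ρ g)).measure_preimage hs.nullMeasurableSet
  · exact hh.quasiErgodic.aeconst_set₀ hs.nullMeasurableSet (hinv h)

/-! ### Powers and the upper central series -/

theorem commutatorElement_pow_left {Γ : Type*} [Group Γ] {z x : Γ} (h : Commute ⁅z, x⁆ z) (k : ℕ) :
    ⁅z ^ k, x⁆ = ⁅z, x⁆ ^ k := by
  have h1 : x * z * x⁻¹ = ⁅z, x⁆⁻¹ * z := by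
    rw [commutatorElement_def]; group
  have h2 : x * z ^ k * x⁻¹ = (⁅z, x⁆ ^ k)⁻¹ * z ^ k := by
    rw [← conj_pow, h1, h.inv_left.mul_pow, inv_pow]
  have h3 : ⁅z ^ k, x⁆ = z ^ k * (x * z ^ k * x⁻¹)⁻¹ := by
    rw [commutatorElement_def]; group
  rw [h3, h2, mul_inv_rev, inv_inv, ← mul_assoc, mul_inv_cancel, one_mul]

theorem mem_upperCentralSeries_succ_iff_commutatorElement {Γ : Type*} [Group Γ] {n : ℕ} {z : Γ} :
    z ∈ Subgroup.upperCentralSeries Γ (n + 1) ↔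
      ∀ x, ⁅z, x⁆ ∈ Subgroup.upperCentralSeries Γ n :=
  Subgroup.mem_upperCentralSeries_succ_iff

/-- Modulo the term of index `i + 1`, `⁅z, x⁆` commutes with `z`, so `⁅z ^ d, x⁆ = ⁅z, x⁆ ^ d`,
which is trivial by the previous stage. -/
theorem pow_mem_upperCentralSeries {Γ : Type*} [Group Γ] {d : ℕ}
    (h : ∀ z ∈ Subgroup.upperCentralSeries Γ 2, z ^ d ∈ Subgroup.upperCentralSeries Γ 1) (i : ℕ) :
    ∀ z ∈ Subgroup.upperCentralSeries Γ (i + 2), z ^ d ∈ Subgroup.upperCentralSeries Γ (i + 1) := by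
  induction i with
  | zero => exact h
  | succ i ih =>
    intro z hz
    rw [mem_upperCentralSeries_succ_iff_commutatorElement] at hz ⊢
    intro x
    have hc := ih _ (hz x)
    have hcz := mem_upperCentralSeries_succ_iff_commutatorElement.mp (hz x) z
    have hcomm : Commute (⁅(z : Γ ⧸ Subgroup.upperCentralSeries Γ (i + 1)),
        (x : Γ ⧸ Subgroup.upperCentralSeries Γ (i + 1))⁆) z := by
      rw [← commutatorElement_eq_one_iff_commute]
      exact (QuotientGroup.eq_one_iff _).mpr hcz
    rw [← QuotientGroup.eq_one_iff] at hc ⊢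
    exact (commutatorElement_pow_left hcomm d).trans hc

theorem exists_pow_mem_center {Γ : Type*} [Group Γ] [Group.IsNilpotent Γ] {d : ℕ} (hd : 0 < d)
    (h : ∀ z ∈ Subgroup.upperCentralSeries Γ 2, z ^ d ∈ Subgroup.upperCentralSeries Γ 1) :
    ∃ m : ℕ, 0 < m ∧ ∀ g : Γ, g ^ m ∈ Subgroup.center Γ := by
  obtain ⟨n, hn⟩ := Group.IsNilpotent.nilpotent Γ
  have key : ∀ i : ℕ, ∀ z ∈ Subgroup.upperCentralSeries Γ (i + 1),
      z ^ d ^ i ∈ Subgroup.upperCentralSeries Γ 1 := by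
    intro i
    induction i with
    | zero => intro z hz; simpa using hz
    | succ i ih =>
      intro z hz
      rw [pow_succ', pow_mul]
      exact ih _ (pow_mem_upperCentralSeries h i z hz)
  refine ⟨d ^ n, by positivity, fun g => ?_⟩
  rw [← Subgroup.upperCentralSeries_one]
  exact key n g (Subgroup.upperCentralSeries_mono Γ (Nat.le_succ n) (hn ▸ Subgroup.mem_top g))

/-! ### Irreducible representations of nilpotent groups -/

theorem LinearMap.det_eq_pow_of_apply_eq_smul {K V : Type*} [Field K] [AddCommGroup V] [Module K V]
    {f : V →ₗ[K] V} {κ : K} (h : ∀ v, f v = κ • v) : LinearMap.det f = κ ^ Module.finrank K V := by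
  have : f = κ • LinearMap.id := LinearMap.ext h
  rw [this, LinearMap.det_smul, LinearMap.det_id, mul_one]

/-- A nonzero representation without nontrivial invariant subspaces. -/
def IsIrreducibleRep {G V : Type*} [Group G] [AddCommGroup V] [Module ℚ V]
    (ρ : G →* Module.End ℚ V) : Prop :=
  Nontrivial V ∧ ∀ W : Submodule ℚ V, (∀ g, ∀ w ∈ W, ρ g w ∈ W) → W = ⊥ ∨ W = ⊤

-- Schur's lemma: kernels of elements of the commutative algebra `K` generated by the central
-- operators are invariant, so `K` is a field. A central commutator is a scalar `κ` on the `K`-space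
-- `V` and has determinant one, so `κ ^ d = 1` with `d` the `K`-dimension of `V`.
open Module in
open scoped IsMulCommutative in
theorem IsIrreducibleRep.exists_field {G : Type*} {V : Type} [Group G] [AddCommGroup V] [Module ℚ V]
    [FiniteDimensional ℚ V] {ρ : G →* Module.End ℚ V} (hρ : IsIrreducibleRep ρ) :
    ∃ (K : Type) (_ : Field K) (_ : NumberField K) (ι : K →+* Module.End ℚ V),
      finrank ℚ K ∣ finrank ℚ V ∧
      (∀ g, (∀ h, Commute (ρ g) (ρ h)) → ∃ κ, ι κ = ρ g) ∧
      ∃ d : ℕ, 0 < d ∧ ∀ g x : G, (∀ h, Commute (ρ ⁅g, x⁆) (ρ h)) → ρ ⁅g, x⁆ ^ d = 1 := by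
  obtain ⟨hV, hirr⟩ := hρ
  set S : Set (Module.End ℚ V) := {f | (∃ g, f = ρ g) ∧ ∀ h, Commute f (ρ h)} with hS
  set K := Algebra.adjoin ℚ S with hK
  have hcomm : ∀ κ ∈ K, ∀ h, Commute κ (ρ h) := by
    intro κ hκ h
    induction hκ using Algebra.adjoin_induction with
    | mem x hx => exact hx.2 h
    | algebraMap r => exact Algebra.commutes r _
    | add x y _ _ hx hy => exact hx.add_left hy
    | mul x y _ _ hx hy => exact hx.mul_left hy
  have := Algebra.isMulCommutative_adjoin ℚ (s := S) (by
    rintro a ⟨_, ha⟩ b ⟨⟨g, rfl⟩, _⟩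
    exact ha g)
  have : IsDomain K := by
    have : NoZeroDivisors K := by
      refine ⟨fun {a b} hab => ?_⟩
      rcases hirr (LinearMap.ker a.val) (fun g w hw => by
        rw [LinearMap.mem_ker] at hw ⊢
        have := LinearMap.congr_fun (hcomm _ a.2 g).eq w
        simp only [Module.End.mul_apply] at this
        rw [this, hw, map_zero]) with h | h
      · right
        have hab' : a.val * b.val = 0 := congrArg Subtype.val hab
        ext v
        have : a.val (b.val v) = 0 := LinearMap.congr_fun hab' v
        have hv : b.val v ∈ LinearMap.ker a.val := this
        rw [h] at hv
        simpa using hv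
      · left
        exact Subtype.ext (LinearMap.ker_eq_top.mp h)
    have : Nontrivial K := inferInstance
    exact NoZeroDivisors.to_isDomain K
  let : Field K := fieldOfFiniteDimensional ℚ K
  let : Module K V := Module.compHom V K.val.toRingHom
  have : IsScalarTower ℚ K V := ⟨fun r κ v => rfl⟩
  have : FiniteDimensional K V := FiniteDimensional.right ℚ K V
  have hdim := Module.finrank_mul_finrank ℚ K V
  let ρK : G →* Module.End K V :=
    { toFun := fun g =>
        { toFun := ρ g
          map_add' := map_add _
          map_smul' := fun κ v => (LinearMap.congr_fun (hcomm _ κ.2 g).eq v).symm }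
      map_one' := by ext v; change ρ 1 v = v; rw [map_one]; rfl
      map_mul' := fun g h => by ext v; change ρ (g * h) v = _; rw [map_mul]; rfl }
  let ι : K →+* Module.End ℚ V := K.val.toRingHom
  have hdet : ∀ g x : G, (∀ h, Commute (ρ ⁅g, x⁆) (ρ h)) → ρ ⁅g, x⁆ ^ finrank K V = 1 := by
    intro g x hgx
    let κ : K := ⟨ρ ⁅g, x⁆, Algebra.subset_adjoin ⟨⟨_, rfl⟩, hgx⟩⟩
    have h1 := LinearMap.det_eq_pow_of_apply_eq_smul (f := ρK ⁅g, x⁆) (κ := κ) fun v => rfl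
    have h2 : LinearMap.det (ρK ⁅g, x⁆) = 1 := by
      have hinv : ∀ y, LinearMap.det (ρK y) * LinearMap.det (ρK y⁻¹) = 1 := fun y => by
        rw [← map_mul, ← map_mul, mul_inv_cancel, map_one, map_one]
      rw [commutatorElement_def]
      simp only [map_mul]
      linear_combination LinearMap.det (ρK x) * LinearMap.det (ρK x⁻¹) * hinv g + hinv x
    rw [h1] at h2
    exact congrArg Subtype.val h2
  have hfd : FiniteDimensional ℚ K := inferInstance
  have hpos : 0 < finrank K V := finrank_pos
  generalize finrank K V = d at *
  have : CharZero K := algebraRat.charZero K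
  -- The `ℚ`-algebra structure coming from the field `K` and the one coming from the subalgebra must
  -- be identified.
  have : NumberField K := @NumberField.mk K _ _ (by
    convert! hfd
    exact Subsingleton.elim _ _)
  refine ⟨K, inferInstance, inferInstance, ι, ⟨d, ?_⟩, ?_, d, hpos, hdet⟩
  · rw [← hdim]
    congr!
    exact Subsingleton.elim _ _
  · intro g hg
    exact ⟨⟨ρ g, Algebra.subset_adjoin ⟨⟨g, rfl⟩, hg⟩⟩, rfl⟩

open Module in
theorem IsIrreducibleRep.exists_field_of_isNilpotent {G : Type*} {V : Type} [Group G] [Group.IsNilpotent G]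
    [AddCommGroup V] [Module ℚ V] [FiniteDimensional ℚ V] {ρ : G →* Module.End ℚ V}
    (hρ : IsIrreducibleRep ρ) :
    ∃ (K : Type) (_ : Field K) (_ : NumberField K) (ι : K →+* Module.End ℚ V),
      finrank ℚ K ∣ finrank ℚ V ∧ ∃ m : ℕ, 0 < m ∧ ∀ g, ∃ κ, ι κ = ρ g ^ m := by
  -- Passing to the image makes the representation faithful, so that `⁅z, x⁆ ^ d = 1` holds in the
  -- group itself.
  set Γ := ρ.toHomUnits.range
  let σ : Γ →* Module.End ℚ V := (Units.coeHom _).comp Γ.subtype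
  have hinj : Function.Injective σ := Units.val_injective.comp Subtype.val_injective
  have hlift : ∀ g, ∃ γ : Γ, σ γ = ρ g := fun g => ⟨⟨ρ.toHomUnits g, g, rfl⟩, rfl⟩
  have hσ : IsIrreducibleRep σ := by
    refine ⟨hρ.1, fun W hW => hρ.2 W fun g w hw => ?_⟩
    obtain ⟨γ, hγ⟩ := hlift g
    exact hγ ▸ hW γ w hw
  have : Group.IsNilpotent Γ :=
    Group.nilpotent_of_surjective ρ.toHomUnits.rangeRestrict ρ.toHomUnits.rangeRestrict_surjective
  obtain ⟨K, hK, hKN, ι, hdvd, hι, d, hd, hw⟩ := hσ.exists_field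
  have hcen : ∀ z ∈ Subgroup.center Γ, ∀ h, Commute (σ z) (σ h) := fun z hz h =>
    Commute.map (Subgroup.mem_center_iff.mp hz h).symm σ
  obtain ⟨m, hm, hpow⟩ := exists_pow_mem_center hd (Γ := Γ) (by
    intro z hz
    rw [Subgroup.upperCentralSeries_one]
    rw [Subgroup.mem_center_iff]
    intro x
    have hzx := mem_upperCentralSeries_succ_iff_commutatorElement.mp hz x
    rw [Subgroup.upperCentralSeries_one] at hzx
    have h1 : ⁅z, x⁆ ^ d = 1 := hinj (by rw [map_pow, map_one]; exact hw z x (hcen _ hzx))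
    rw [← commutatorElement_pow_left (Subgroup.mem_center_iff.mp hzx z).symm,
      commutatorElement_eq_one_iff_mul_comm] at h1
    exact h1.symm)
  refine ⟨K, hK, hKN, ι, hdvd, m, hm, fun g => ?_⟩
  obtain ⟨γ, hγ⟩ := hlift g
  obtain ⟨κ, hκ⟩ := hι (γ ^ m) (hcen _ (hpow γ))
  exact ⟨κ, by rw [hκ, map_pow, hγ]⟩

/-! ### Units with a conjugate on the unit circle -/

-- On the circle inversion is conjugation, so `φ` is real on `ℚ(a + a⁻¹)`. That field misses `a`,
-- hence has index two in its extension by `a`.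
open Module IntermediateField Polynomial ComplexConjugate in
theorem even_finrank_of_norm_eq_one {K : Type*} [Field K] [NumberField K] (φ : K →+* ℂ) {a : K}
    (ha : ‖φ a‖ = 1) (ha2 : a ^ 2 ≠ 1) : Even (finrank ℚ K) := by
  have ha0 : a ≠ 0 := by
    rintro rfl
    simp at ha
  have hinv : φ a⁻¹ = conj (φ a) := by
    rw [map_inv₀, Complex.inv_def, Complex.normSq_eq_norm_sq, ha]
    simp
  have hreal : ∀ x ∈ ℚ⟮a + a⁻¹⟯, conj (φ x) = φ x := by
    intro x hx
    induction hx using IntermediateField.adjoin_induction with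
    | mem x hx =>
      rw [Set.mem_singleton_iff] at hx
      rw [hx, map_add, hinv, map_add, Complex.conj_conj, add_comm]
    | algebraMap r => simp
    | add x y _ _ hx hy => rw [map_add, map_add, hx, hy]
    | inv x _ hx => rw [map_inv₀, map_inv₀, hx]
    | mul x y _ _ hx hy => rw [map_mul, map_mul, hx, hy]
  set F := ℚ⟮a + a⁻¹⟯
  have haF : a ∉ F := by
    intro h
    have h1 := hreal a h
    rw [← hinv] at h1
    have h2 := φ.injective h1
    apply ha2
    rw [sq]
    nth_rewrite 1 [← h2]
    exact inv_mul_cancel₀ ha0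
  set u : F := ⟨a + a⁻¹, mem_adjoin_simple_self ℚ _⟩
  have hint : IsIntegral F a := Algebra.IsIntegral.isIntegral a
  have hdeg : (minpoly F a).natDegree = 2 := by
    have hle : (minpoly F a).natDegree ≤ 2 := by
      have hq : (X ^ 2 - C u * X + 1 : F[X]).natDegree = 2 := by compute_degree!
      rw [← hq]
      refine natDegree_le_of_dvd (minpoly.dvd F a ?_) ?_
      · have : algebraMap F K u = a + a⁻¹ := rfl
        simp only [map_add, map_sub, map_mul, map_pow, aeval_X, aeval_C, map_one, this]
        field_simp
        ring
      · intro h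
        rw [h] at hq
        simp at hq
    have hpos := minpoly.natDegree_pos hint
    have h1 : (minpoly F a).natDegree ≠ 1 := by
      rw [Ne, minpoly.natDegree_eq_one_iff]
      rintro ⟨x, hx⟩
      exact haF (hx ▸ x.2)
    omega
  rw [← finrank_mul_finrank ℚ F K, ← finrank_mul_finrank F F⟮a⟯ K, adjoin.finrank hint, hdeg]
  exact ((even_two.mul_right _).mul_left _)

open NumberField in
theorem NumberField.Units.sum_log_norm_embedding {K : Type*} [Field K] [NumberField K]
    (x : (𝓞 K)ˣ) : ∑ ψ : K →+* ℂ, Real.log ‖ψ x‖ = 0 := by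
  have h1 : ∏ ψ : K →+* ℂ, ‖ψ x‖ = 1 := by
    have h2 := Algebra.norm_eq_prod_embeddings ℚ ℂ (x : K)
    have h3 : ‖((Algebra.norm ℚ (x : K) : ℚ) : ℂ)‖ = 1 := by
      have h4 := NumberField.isUnit_iff_norm.mp x.isUnit
      rw [RingOfIntegers.coe_norm] at h4
      rw [Complex.norm_ratCast]
      exact_mod_cast h4
    have h5 := congrArg norm h2
    rw [norm_prod, eq_ratCast, h3] at h5
    rw [h5]
    exact Fintype.prod_equiv (RingHom.equivRatAlgHom K ℂ) _ _ fun ψ => rfl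
  have h6 := congrArg Real.log h1
  rwa [Real.log_prod (fun ψ _ => by simp), Real.log_one] at h6

open NumberField in
theorem NumberField.Units.log_norm_zpow_mul_zpow {K : Type*} [Field K] [NumberField K]
    (ψ : K →+* ℂ) (a b : (𝓞 K)ˣ) (k l : ℤ) : Real.log ‖ψ ((a ^ k * b ^ l : (𝓞 K)ˣ) : K)‖ =
      k * Real.log ‖ψ a‖ + l * Real.log ‖ψ b‖ := by
  have hne : ∀ x : (𝓞 K)ˣ, ‖ψ x‖ ≠ 0 := fun x => by simp
  rw [NumberField.Units.coe_mul, map_mul, norm_mul, NumberField.Units.coe_zpow,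
    NumberField.Units.coe_zpow, map_zpow₀, map_zpow₀, norm_zpow,
    norm_zpow, Real.log_mul (zpow_ne_zero _ (hne a)) (zpow_ne_zero _ (hne b)), Real.log_zpow,
    Real.log_zpow]

-- Besides `φ` and its conjugate at most two embeddings remain, and there the logarithms sum to
-- zero; any one of them controls the whole vector.
open Module NumberField ComplexConjugate in
theorem exists_abs_log_embedding_le {K : Type*} [Field K] [NumberField K] (hK : finrank ℚ K ≤ 4)
    {φ : K →+* ℂ} (hφ : (starRingEnd ℂ).comp φ ≠ φ) :
    ∃ τ : K →+* ℂ, ∀ x : (𝓞 K)ˣ, ‖φ x‖ = 1 → ∀ ψ : K →+* ℂ,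
      |Real.log ‖ψ x‖| ≤ |Real.log ‖τ x‖| := by
  classical
  set φ' := (starRingEnd ℂ).comp φ with hφ'
  set O : Finset (K →+* ℂ) := (Finset.univ.erase φ).erase φ' with hO
  have hcard : O.card ≤ 2 := by
    rw [hO, Finset.card_erase_of_mem (by simp [hφ]), Finset.card_erase_of_mem (Finset.mem_univ _),
      Finset.card_univ, Embeddings.card]
    omega
  have hnorm' : ∀ x : K, ‖φ' x‖ = ‖φ x‖ := fun x => by simp [hφ']
  have hmem : ∀ ψ, ψ = φ ∨ ψ = φ' ∨ ψ ∈ O := by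
    intro ψ
    by_cases h1 : ψ = φ
    · exact Or.inl h1
    · by_cases h2 : ψ = φ'
      · exact Or.inr (Or.inl h2)
      · exact Or.inr (Or.inr (by simp [hO, h1, h2]))
  have hsum : ∀ x : (𝓞 K)ˣ, ‖φ x‖ = 1 → ∑ ψ ∈ O, Real.log ‖ψ x‖ = 0 := by
    intro x hx
    have h6 := NumberField.Units.sum_log_norm_embedding x
    rw [← Finset.add_sum_erase _ _ (Finset.mem_univ φ),
      ← Finset.add_sum_erase (Finset.univ.erase φ) _ (a := φ') (by simp [hφ]), hnorm', hx] at h6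
    simpa using h6
  have hcases : O.card = 0 ∨ O.card = 1 ∨ O.card = 2 := by omega
  rcases hcases with h | h | h
  · rw [Finset.card_eq_zero] at h
    refine ⟨φ, fun x hx ψ => ?_⟩
    rcases hmem ψ with rfl | rfl | h'
    · rfl
    · rw [hnorm']
    · simp [h] at h'
  · obtain ⟨τ, hτ⟩ := Finset.card_eq_one.mp h
    refine ⟨τ, fun x hx ψ => ?_⟩
    rcases hmem ψ with rfl | rfl | h'
    · simp [hx]
    · simp [hnorm', hx]
    · rw [hτ, Finset.mem_singleton] at h'
      rw [h']
  · obtain ⟨τ, τ', hne, hτ⟩ := Finset.card_eq_two.mp h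
    refine ⟨τ, fun x hx ψ => ?_⟩
    have hs := hsum x hx
    rw [hτ, Finset.sum_pair hne] at hs
    rcases hmem ψ with rfl | rfl | h'
    · simp [hx]
    · simp [hnorm', hx]
    · rw [hτ, Finset.mem_insert, Finset.mem_singleton] at h'
      rcases h' with rfl | rfl
      · rfl
      · rw [eq_neg_of_add_eq_zero_right hs, abs_neg]

open Module NumberField ComplexConjugate in
theorem exists_zpow_mul_zpow_eq_one {K : Type*} [Field K] [NumberField K] (hK : finrank ℚ K ≤ 4)
    {φ : K →+* ℂ} {a b : (𝓞 K)ˣ} (ha : ‖φ a‖ = 1) (hb : ‖φ b‖ = 1) :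
    ∃ k : ℤ × ℤ, k ≠ 0 ∧ a ^ k.1 * b ^ k.2 = 1 := by
  by_cases hφ : (starRingEnd ℂ).comp φ = φ
  · refine ⟨(2, 0), by simp, ?_⟩
    have h1 : conj (φ a) = φ a := RingHom.congr_fun hφ _
    obtain ⟨r, hr⟩ := Complex.conj_eq_iff_real.mp h1
    have h2 : φ ((a : K) ^ 2) = φ 1 := by
      rw [hr, Complex.norm_real, Real.norm_eq_abs] at ha
      rw [map_pow, map_one, hr, ← Complex.ofReal_pow, ← sq_abs, ha]
      simp
    have h3 := φ.injective h2
    rw [zpow_zero, mul_one]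
    apply NumberField.Units.coe_injective K
    exact (NumberField.Units.coe_pow a 2).trans h3
  obtain ⟨τ, hτ⟩ := exists_abs_log_embedding_le hK hφ
  have hlog := fun ψ => NumberField.Units.log_norm_zpow_mul_zpow ψ a b
  have hone : ∀ k l : ℤ, ‖φ ((a ^ k * b ^ l : (𝓞 K)ˣ) : K)‖ = 1 := by
    intro k l
    rw [NumberField.Units.coe_mul, map_mul, norm_mul, NumberField.Units.coe_zpow,
      NumberField.Units.coe_zpow, map_zpow₀, map_zpow₀, norm_zpow,
      norm_zpow, ha, hb, one_zpow, one_zpow, one_mul]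
  by_cases hfb : Real.log ‖τ b‖ = 0
  · have h1 : ∀ ψ : K →+* ℂ, ‖ψ b‖ = 1 := by
      intro ψ
      have h2 := hτ b hb ψ
      rw [hfb, abs_zero, abs_nonpos_iff] at h2
      exact Real.eq_one_of_pos_of_log_eq_zero (by simp) h2
    obtain ⟨n, hn, h⟩ := Embeddings.pow_eq_one_of_norm_eq_one K ℂ b.val.isIntegral_coe h1
    refine ⟨(0, n), by simp [hn.ne'], ?_⟩
    rw [zpow_zero, one_mul, zpow_natCast]
    apply NumberField.Units.coe_injective K
    exact (NumberField.Units.coe_pow b n).trans h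
  · set s := Real.log ‖τ a‖
    set t := Real.log ‖τ b‖
    -- Rounding keeps all conjugates of `a ^ k * b ^ L k` bounded. Only finitely many algebraic
    -- integers of `K` satisfy the bound, so two exponents give the same unit.
    let L : ℕ → ℤ := fun k => -round (k * s / t)
    have hL : ∀ k : ℕ, |k * s + L k * t| ≤ |t| := by
      intro k
      have h1 : k * s + L k * t = (k * s / t - round (k * s / t)) * t := by
        simp only [L]
        push_cast
        field_simp
        ring
      rw [h1, abs_mul]
      have h2 := abs_sub_round ((k : ℝ) * s / t)
      nlinarith [abs_nonneg t]
    have hfin := Embeddings.finite_of_norm_le K ℂ (Real.exp |t|)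
    have hni : ¬ Function.Injective fun k : ℕ => ((a ^ (k : ℤ) * b ^ L k : (𝓞 K)ˣ) : K) := by
      intro hinj
      refine Set.infinite_of_injective_forall_mem hinj (fun k => ?_) hfin
      refine ⟨RingOfIntegers.isIntegral_coe _, fun ψ => ?_⟩
      have h1 := hτ (a ^ (k : ℤ) * b ^ L k) (hone _ _) ψ
      rw [hlog τ] at h1
      have h2 := (le_abs_self _).trans (h1.trans (by simpa using hL k))
      rwa [Real.log_le_iff_le_exp (by simp)] at h2
    simp only [Function.Injective, not_forall] at hni
    obtain ⟨k, k', hkk, hne⟩ := hni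
    refine ⟨((k : ℤ) - k', L k - L k'), fun h => ?_, ?_⟩
    · simp only [Prod.mk_eq_zero] at h
      omega
    · have h1 : a ^ (k : ℤ) * b ^ L k = a ^ (k' : ℤ) * b ^ L k' := by
        exact NumberField.Units.coe_injective K hkk
      rw [zpow_sub, zpow_sub, mul_mul_mul_comm, ← mul_inv, h1, mul_inv_cancel]

/-! ### Composition factors and eigenvalues -/

open Polynomial in
theorem LinearMap.charpoly_eq_restrict_mul_mapQ {V : Type*} [AddCommGroup V] [Module ℚ V]
    [FiniteDimensional ℚ V] (W : Submodule ℚ V) (f : Module.End ℚ V) (h : W ≤ W.comap f) :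
    f.charpoly = (f.restrict h).charpoly * (W.mapQ W f h).charpoly := by
  refine Polynomial.funext fun t => ?_
  have ht : W ≤ W.comap (algebraMap ℚ (Module.End ℚ V) t - f) := fun w hw =>
    W.sub_mem (W.smul_mem t hw) (h hw)
  rw [eval_mul, LinearMap.eval_charpoly, LinearMap.eval_charpoly, LinearMap.eval_charpoly,
    LinearMap.det_eq_det_mul_det W _ ht]
  congr 2
  ext x
  rfl

-- Only characteristic polynomials are tracked, so a composition series suffices and no
-- semisimplicity is needed. Factors are moved to `Fin d → ℚ` so that they fit in one list.
open Module in
theorem exists_irreducibleRep_factors {G : Type*} [Group G] (n : ℕ) :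
    ∀ (V : Type) [AddCommGroup V] [Module ℚ V] [FiniteDimensional ℚ V] (ρ : G →* Module.End ℚ V),
      finrank ℚ V = n → ∃ l : List (Σ d : ℕ, G →* Module.End ℚ (Fin d → ℚ)),
        (∀ s ∈ l, IsIrreducibleRep s.2) ∧
          ∀ g, (ρ g).charpoly = (l.map fun s => (s.2 g).charpoly).prod := by
  induction n using Nat.strong_induction_on with
  | _ n ih =>
    intro V _ _ _ ρ hn
    rcases subsingleton_or_nontrivial V with hV | hV
    · refine ⟨[], by simp, fun g => ?_⟩
      simp only [List.map_nil, List.prod_nil]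
      rw [← (LinearMap.charpoly_monic (ρ g)).natDegree_eq_zero, LinearMap.charpoly_natDegree]
      exact finrank_zero_of_subsingleton
    by_cases hirr : ∀ W : Submodule ℚ V, (∀ g, ∀ w ∈ W, ρ g w ∈ W) → W = ⊥ ∨ W = ⊤
    · let e : V ≃ₗ[ℚ] (Fin n → ℚ) := (finBasisOfFinrankEq ℚ V hn).equivFun
      refine ⟨[⟨n, (e.conjRingEquiv : End ℚ V →* End ℚ (Fin n → ℚ)).comp ρ⟩], ?_, fun g => ?_⟩
      · simp only [List.mem_singleton, forall_eq]
        refine ⟨e.symm.toEquiv.nontrivial, fun W hW => ?_⟩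
        rcases hirr (W.comap e.toLinearMap) (fun g w hw => by
          have := hW g _ hw
          simpa [LinearEquiv.conj_apply] using this) with h | h
        · left
          rw [Submodule.eq_bot_iff]
          intro w hw
          have h1 : e.symm w ∈ W.comap e.toLinearMap := by simpa using hw
          rw [h] at h1
          simpa using h1
        · right
          rw [Submodule.eq_top_iff']
          intro w
          have h1 : e.symm w ∈ W.comap e.toLinearMap := h ▸ Submodule.mem_top
          simpa using h1
      · simp only [List.map_singleton, List.prod_singleton]
        exact (e.charpoly_conj (ρ g)).symm
    · push Not at hirr
      obtain ⟨W, hW, hbot, htop⟩ := hirr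
      let ρW : G →* End ℚ W :=
        { toFun := fun g => (ρ g).restrict (hW g)
          map_one' := by ext; simp
          map_mul' := fun g h => by ext; simp [map_mul] }
      let ρQ : G →* End ℚ (V ⧸ W) :=
        { toFun := fun g => W.mapQ W (ρ g) (hW g)
          map_one' := by ext; simp
          map_mul' := fun g h => by ext; simp [map_mul] }
      have hadd := W.finrank_quotient_add_finrank
      have hWpos : 0 < finrank ℚ W := by
        have := (Submodule.nontrivial_iff_ne_bot).mpr hbot
        exact finrank_pos
      have hWlt : finrank ℚ W < n := hn ▸ Submodule.finrank_lt htop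
      obtain ⟨l₁, h₁, hl₁⟩ := ih _ hWlt W ρW rfl
      obtain ⟨l₂, h₂, hl₂⟩ := ih (finrank ℚ (V ⧸ W)) (by omega) (V ⧸ W) ρQ rfl
      refine ⟨l₁ ++ l₂, fun s hs => ?_, fun g => ?_⟩
      · rcases List.mem_append.mp hs with h | h
        · exact h₁ s h
        · exact h₂ s h
      · rw [List.map_append, List.prod_append, ← hl₁, ← hl₂]
        exact LinearMap.charpoly_eq_restrict_mul_mapQ W (ρ g) (hW g)

open Polynomial in
theorem aeval_eq_zero_of_isRoot_charpoly {V : Type*} [AddCommGroup V] [Module ℚ V]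
    [FiniteDimensional ℚ V] {f : Module.End ℚ V} {p : ℚ[X]} (hp : aeval f p = 0) {z : ℂ}
    (hz : (f.charpoly.map (algebraMap ℚ ℂ)).IsRoot z) : aeval z p = 0 := by
  let b := Module.finBasis ℚ V
  set M := LinearMap.toMatrix b b f with hM
  have h1 : z ∈ spectrum ℂ (M.map (algebraMap ℚ ℂ)) := by
    rw [Matrix.mem_spectrum_iff_isRoot_charpoly, Matrix.charpoly_map,
      hM, LinearMap.charpoly_toMatrix]
    exact hz
  have h2 : aeval (M.map (algebraMap ℚ ℂ)) (p.map (algebraMap ℚ ℂ)) = 0 := by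
    have h3 : aeval M p = 0 := by
      have := Polynomial.aeval_algHom_apply (LinearMap.toMatrixAlgEquiv b).toAlgHom f p
      rw [hp, map_zero] at this
      exact this
    have h4 := Polynomial.aeval_algHom_apply ((Algebra.ofId ℚ ℂ).mapMatrix (m := Fin _)) M p
    rw [h3, map_zero] at h4
    rw [aeval_map_algebraMap]
    exact h4
  have h3 := spectrum.subset_polynomial_aeval _ (p.map (algebraMap ℚ ℂ)) ⟨z, h1, rfl⟩
  rw [h2] at h3
  have : Nontrivial (Matrix (Fin (Module.finrank ℚ V)) (Fin (Module.finrank ℚ V)) ℂ) := by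
    by_contra hn
    rw [not_nontrivial_iff_subsingleton] at hn
    simp [spectrum.of_subsingleton] at h1
  rw [spectrum.zero_eq, Set.mem_singleton_iff] at h3
  rw [← eval_map_algebraMap]
  exact h3

-- The minimal polynomial of `κ` annihilates `ι κ`, so every eigenvalue is a conjugate of `κ`.
open Polynomial in
theorem exists_embedding_of_isRoot_charpoly {K V : Type*} [Field K] [NumberField K]
    [AddCommGroup V] [Module ℚ V] [FiniteDimensional ℚ V] (ι : K →+* Module.End ℚ V) {κ : K}
    {z : ℂ} (hz : ((ι κ).charpoly.map (algebraMap ℚ ℂ)).IsRoot z) : ∃ φ : K →+* ℂ, φ κ = z := by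
  have h1 : aeval (ι κ) (minpoly ℚ κ) = 0 := by
    have := Polynomial.aeval_algHom_apply ι.toRatAlgHom κ (minpoly ℚ κ)
    rw [minpoly.aeval, map_zero] at this
    exact this
  have h2 := aeval_eq_zero_of_isRoot_charpoly h1 hz
  have h3 : z ∈ (minpoly ℚ κ).rootSet ℂ :=
    (mem_rootSet_of_ne (minpoly.ne_zero (Algebra.IsIntegral.isIntegral κ))).mpr h2
  rw [← NumberField.Embeddings.range_eval_eq_rootSet_minpoly] at h3
  exact h3

open Module NumberField in
theorem IsIrreducibleRep.exists_field_units {G : Type*} {V : Type} [Group G] [Group.IsNilpotent G]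
    [AddCommGroup V] [Module ℚ V] [FiniteDimensional ℚ V] {σ : G →* Module.End ℚ V}
    (hσ : IsIrreducibleRep σ) (hint : ∀ g, IsIntegral ℤ (σ g)) :
    ∃ (K : Type) (_ : Field K) (_ : NumberField K) (ι : K →+* Module.End ℚ V),
      finrank ℚ K ∣ finrank ℚ V ∧ ∃ m : ℕ, 0 < m ∧ ∀ g, ∃ u : (𝓞 K)ˣ,
        Units.map (ι.comp (algebraMap (𝓞 K) K)).toMonoidHom u = σ.toHomUnits (g ^ m) := by
  obtain ⟨K, hK, hKN, ι, hdvd, m, hm, hι⟩ := hσ.exists_field_of_isNilpotent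
  have := hσ.1
  refine ⟨K, hK, hKN, ι, hdvd, m, hm, fun g => ?_⟩
  have hkey : ∀ g, ∃ κ : 𝓞 K, ι κ = σ g ^ m := by
    intro g
    obtain ⟨κ, hκ⟩ := hι g
    have h1 : IsIntegral ℤ κ := by
      rw [← isIntegral_algHom_iff ι.toIntAlgHom ι.injective]
      exact hκ ▸ (hint g).pow m
    exact ⟨⟨κ, h1⟩, hκ⟩
  obtain ⟨κ, hκ⟩ := hkey g
  obtain ⟨κ', hκ'⟩ := hkey g⁻¹
  have h1 : κ * κ' = 1 := by
    apply RingOfIntegers.coe_injective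
    apply ι.injective
    rw [map_mul, map_mul, hκ, hκ', map_one, map_one, ← map_pow, ← map_pow, ← map_mul, inv_pow,
      mul_inv_cancel, map_one]
  refine ⟨Units.mkOfMulEqOne κ κ' h1, ?_⟩
  ext1
  rw [MonoidHom.coe_toHomUnits, map_pow, ← hκ]
  rfl

open Polynomial Module NumberField in
theorem exists_even_dvd_of_irreducibleRep_factors {G : Type*} [Group G] [Group.IsNilpotent G]
    {l : List (Σ d : ℕ, G →* Module.End ℚ (Fin d → ℚ))} (hl : ∀ s ∈ l, IsIrreducibleRep s.2)
    (hint : ∀ s ∈ l, ∀ g, IsIntegral ℤ (s.2 g)) {A B : G}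
    (herg : ∀ k : ℤ × ℤ, k ≠ 0 → ∀ s ∈ l, (s.2 (A ^ k.1 * B ^ k.2)).charpoly.eval 1 ≠ 0)
    (hunit : ∀ g : G, ∃ z : ℂ, ‖z‖ = 1 ∧
      ((l.map fun s : (Σ d : ℕ, G →* Module.End ℚ (Fin d → ℚ)) => (s.2 g).charpoly).prod.map (algebraMap ℚ ℂ)).IsRoot z) :
    ∃ s ∈ l, ∃ e : ℕ, Even e ∧ 6 ≤ e ∧ e ∣ s.1 := by
  have hdata := fun i : Fin l.length =>
    (hl _ (l.get_mem i)).exists_field_units (hint _ (l.get_mem i))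
  choose K hK hKN ι hdvd m hm hu using hdata
  -- A common exponent that brings every element into the field of every factor.
  set M := ∏ i, m i with hM
  have hMpos : 0 < M := Finset.prod_pos fun i _ => hm i
  have hunits : ∀ i g, ∃ u : (𝓞 (K i))ˣ,
      Units.map ((ι i).comp (algebraMap (𝓞 (K i)) (K i))).toMonoidHom u =
        (l.get i).2.toHomUnits (g ^ M) := by
    intro i g
    obtain ⟨c, hc⟩ := Finset.dvd_prod_of_mem m (Finset.mem_univ i)
    obtain ⟨u, hu⟩ := hu i (g ^ c)
    exact ⟨u, by rw [hu, hM, hc, mul_comm, pow_mul]⟩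
  choose a ha using fun i => hunits i A
  choose b hb using fun i => hunits i B
  have hab : ∀ i (k j : ℤ),
      Units.map ((ι i).comp (algebraMap (𝓞 (K i)) (K i))).toMonoidHom (a i ^ k * b i ^ j) =
        (l.get i).2.toHomUnits (A ^ (M * k) * B ^ (M * j)) := by
    intro i k j
    rw [map_mul, map_zpow, map_zpow, ha, hb, ← map_zpow, ← map_zpow, ← map_mul, zpow_mul, zpow_mul,
      zpow_natCast, zpow_natCast]
  have hindep : ∀ i (k : ℤ × ℤ), k ≠ 0 → a i ^ k.1 * b i ^ k.2 ≠ 1 := by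
    intro i k hk h
    refine herg (M * k.1, M * k.2) (fun h0 => hk ?_) _ (l.get_mem i) ?_
    · simp only [Prod.mk_eq_zero, mul_eq_zero, Nat.cast_eq_zero, hMpos.ne', false_or] at h0
      exact Prod.ext h0.1 h0.2
    · have h1 := hab i k.1 k.2
      rw [h, map_one] at h1
      have h2 := congrArg Units.val h1
      rw [MonoidHom.coe_toHomUnits, Units.val_one] at h2
      have := (hl _ (l.get_mem i)).1
      dsimp only
      rw [← h2, LinearMap.eval_charpoly, map_one, sub_self, LinearMap.det_zero,
        zero_pow finrank_pos.ne']
  have hstep : ∀ t : ℕ, ∃ p : (Σ i, K i →+* ℂ),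
      ‖p.2 (a p.1)‖ * ‖p.2 (b p.1)‖ ^ t = 1 := by
    intro t
    obtain ⟨z, hz, hroot⟩ := hunit (A ^ ((M : ℤ) * 1) * B ^ ((M : ℤ) * t))
    have h1 : ∃ s ∈ l, ((s.2 (A ^ ((M : ℤ) * 1) * B ^ ((M : ℤ) * t))).charpoly.map
        (algebraMap ℚ ℂ)).IsRoot z := by
      rw [← coe_mapRingHom, map_list_prod, IsRoot, ← coe_evalRingHom, map_list_prod,
        List.prod_eq_zero_iff] at hroot
      simpa [IsRoot] using hroot
    obtain ⟨s, hs, hsz⟩ := h1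
    obtain ⟨i, rfl⟩ := List.get_of_mem hs
    have h2 := congrArg Units.val (hab i 1 t)
    rw [MonoidHom.coe_toHomUnits] at h2
    rw [← h2] at hsz
    obtain ⟨φ, hφ⟩ := exists_embedding_of_isRoot_charpoly (ι i) hsz
    refine ⟨⟨i, φ⟩, ?_⟩
    rw [← hz, ← hφ, zpow_one, zpow_natCast, ← norm_pow, ← norm_mul, ← map_pow, ← map_mul]
    rfl
  choose p hp using hstep
  -- There are finitely many pairs (factor, embedding). Two values of `t` with the same pair give
  -- `‖φ b‖ ^ t = ‖φ b‖ ^ t'`, hence `‖φ b‖ = 1` and then `‖φ a‖ = 1`.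
  obtain ⟨t, t', hne, htt⟩ := Finite.exists_ne_map_eq_of_infinite p
  have hpt := hp t
  have hpt' := hp t'
  rw [← htt] at hpt'
  generalize p t = q at hpt hpt'
  obtain ⟨i, φ⟩ := q
  dsimp only at hpt hpt'
  have hφa : ‖φ (a i)‖ ≠ 0 := by simp
  have hφb : ‖φ (b i)‖ = 1 := by
    by_contra h
    refine hne (pow_right_injective₀ (a := ‖φ (b i)‖) (by simp) h ?_)
    exact mul_left_cancel₀ hφa (hpt.trans hpt'.symm)
  have hφa : ‖φ (a i)‖ = 1 := by
    rw [hφb, one_pow, mul_one] at hpt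
    exact hpt
  refine ⟨l.get i, l.get_mem i, finrank ℚ (K i), ?_, ?_, by simpa using hdvd i⟩
  · refine even_finrank_of_norm_eq_one φ hφa fun h => hindep i (2, 0) (by simp) ?_
    rw [zpow_zero, mul_one]
    exact NumberField.Units.coe_injective (K i) ((NumberField.Units.coe_pow _ 2).trans h)
  · have heven : Even (finrank ℚ (K i)) := by
      refine even_finrank_of_norm_eq_one φ hφa fun h => hindep i (2, 0) (by simp) ?_
      rw [zpow_zero, mul_one]
      exact NumberField.Units.coe_injective (K i) ((NumberField.Units.coe_pow _ 2).trans h)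
    by_contra hlt
    obtain ⟨k, hk, h⟩ := exists_zpow_mul_zpow_eq_one (by
      obtain ⟨c, hc⟩ := heven
      omega) hφa hφb
    exact hindep i k hk h

/-! ### Obstructions in odd and small dimensions -/

/-- The rational representation underlying an action by toral automorphisms. -/
def rationalRep {H : Type*} [Group H] {N : ℕ} (ρ : H →* Matrix.GeneralLinearGroup (Fin N) ℤ) :
    H →* Module.End ℚ (Fin N → ℚ) :=
  (Matrix.toLinAlgEquiv' (R := ℚ) (n := Fin N)).toAlgHom.toRingHom.toMonoidHom.comp
    ((Int.castRingHom ℚ).mapMatrix.toMonoidHom.comp ((Units.coeHom _).comp ρ))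

theorem charpoly_rationalRep {H : Type*} [Group H] {N : ℕ}
    (ρ : H →* Matrix.GeneralLinearGroup (Fin N) ℤ) (h : H) :
    (rationalRep ρ h).charpoly = (ρ h).val.charpoly.map (Int.castRingHom ℚ) := by
  rw [← Matrix.charpoly_map]
  exact Matrix.charpoly_toLin' _

open Polynomial in
theorem eval_one_charpoly_rationalRep_ne_zero {H : Type*} [Group H] {N : ℕ}
    {ρ : H →* Matrix.GeneralLinearGroup (Fin N) ℤ} {h : H} (hh : IsErgodicElement (ρ h)) :
    (rationalRep ρ h).charpoly.eval 1 ≠ 0 := by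
  have h1 := Ergodic.det_sub_one_ne_zero hh
  rw [charpoly_rationalRep, ← Int.cast_one, ← eq_intCast (Int.castRingHom ℚ), eval_map_apply,
    Matrix.eval_charpoly, map_one, ← neg_sub, Matrix.det_neg]
  simp [h1]

open Polynomial in
theorem exists_isRoot_of_not_isHyperbolicElement {H : Type*} [Group H] {N : ℕ}
    {ρ : H →* Matrix.GeneralLinearGroup (Fin N) ℤ} {h : H} (hh : ¬ IsHyperbolicElement (ρ h)) :
    ∃ z : ℂ, ‖z‖ = 1 ∧ ((rationalRep ρ h).charpoly.map (algebraMap ℚ ℂ)).IsRoot z := by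
  unfold IsHyperbolicElement at hh
  push Not at hh
  obtain ⟨z, hz, hnorm⟩ := hh
  refine ⟨z, hnorm, ?_⟩
  rw [Matrix.mem_spectrum_iff_isRoot_charpoly] at hz
  rw [charpoly_rationalRep, Polynomial.map_map]
  have := Matrix.charpoly_map (ρ h).val (Int.castRingHom ℂ)
  rw [RingHom.eq_intCast' ((algebraMap ℚ ℂ).comp (Int.castRingHom ℚ)), ← this]
  exact hz

open Polynomial in
theorem isIntegral_of_charpoly_dvd {H V : Type*} [Group H] [AddCommGroup V] [Module ℚ V]
    [FiniteDimensional ℚ V] {N : ℕ} {ρ : H →* Matrix.GeneralLinearGroup (Fin N) ℤ} {h : H}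
    {f : Module.End ℚ V} (hf : f.charpoly ∣ (rationalRep ρ h).charpoly) : IsIntegral ℤ f := by
  refine ⟨(ρ h).val.charpoly, Matrix.charpoly_monic _, ?_⟩
  rw [charpoly_rationalRep] at hf
  have h1 := Polynomial.aeval_eq_zero_of_dvd_aeval_eq_zero hf (LinearMap.aeval_self_charpoly f)
  rw [← algebraMap_int_eq, aeval_map_algebraMap] at h1
  exact h1

open Polynomial in
/-- A rational eigenvalue of an element of `GL(N, ℤ)` is `1` or `-1`. -/
theorem eval_one_charpoly_sq_of_isRoot {H : Type*} [Group H] {N : ℕ}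
    {ρ : H →* Matrix.GeneralLinearGroup (Fin N) ℤ} {h : H} {r : ℚ}
    (hr : (rationalRep ρ h).charpoly.IsRoot r) :
    (rationalRep ρ (h ^ (2 : ℤ))).charpoly.eval 1 = 0 := by
  have hr1 : r ^ 2 = 1 := by
    have h1 : aeval r (ρ h).val.charpoly = 0 := by
      rw [charpoly_rationalRep] at hr
      rw [← aeval_map_algebraMap ℚ, algebraMap_int_eq, coe_aeval_eq_eval]
      exact hr
    obtain ⟨n, hn⟩ := isInteger_of_is_root_of_monic (Matrix.charpoly_monic _) h1
    rw [← hn, aeval_algebraMap_apply, FaithfulSMul.algebraMap_eq_zero_iff, coe_aeval_eq_eval] at h1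
    have h2 := sub_dvd_eval_sub n 0 (ρ h).val.charpoly
    rw [h1, Matrix.eval_charpoly, map_zero, zero_sub, zero_sub, dvd_neg, sub_zero] at h2
    have h3 : IsUnit (-(ρ h).val).det :=
      (Matrix.isUnit_iff_isUnit_det _).mp (ρ h).isUnit.neg
    have h4 := Int.isUnit_iff.mp (isUnit_of_dvd_unit h2 h3)
    rw [← hn]
    rcases h4 with rfl | rfl <;> simp
  have h1 : (rationalRep ρ h).HasEigenvalue r :=
    (Module.End.hasEigenvalue_iff_isRoot_charpoly _ _).mpr hr
  have h2 := h1.pow 2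
  rw [hr1, ← map_pow] at h2
  rw [zpow_ofNat]
  exact (Module.End.hasEigenvalue_iff_isRoot_charpoly _ _).mp h2

open Polynomial in
theorem not_isIrreducibleAction_of_odd {H : Type*} [Group H] [Group.IsNilpotent H] {N : ℕ}
    (hN : Odd N) (ρ : H →* Matrix.GeneralLinearGroup (Fin N) ℤ)
    (hgph : IsGenuinelyPartiallyHyperbolic ρ) (hhr : IsHigherRank ρ) : ¬ IsIrreducibleAction ρ := by
  intro hirr
  obtain ⟨_, ⟨A, rfl⟩, _, ⟨B, rfl⟩, herg⟩ := hhr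
  have : Nonempty (Fin N) := ⟨⟨0, hN.pos⟩⟩
  have hrep : IsIrreducibleRep (rationalRep ρ) := ⟨inferInstance, hirr⟩
  obtain ⟨s, hs, e, he, -, hdvd⟩ := exists_even_dvd_of_irreducibleRep_factors
    (l := [⟨N, rationalRep ρ⟩]) (A := A) (B := B) (by simpa using hrep)
    (by simpa using fun g => isIntegral_of_charpoly_dvd (dvd_refl _))
    (fun k hk => by
      simp only [List.mem_singleton, forall_eq]
      refine eval_one_charpoly_rationalRep_ne_zero ?_
      rw [map_mul, map_zpow, map_zpow]
      exact herg k hk)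
    (fun g => by simpa using exists_isRoot_of_not_isHyperbolicElement (hgph.2 g))
  rw [List.mem_singleton] at hs
  subst hs
  exact Nat.not_even_iff_odd.mpr hN (he.trans_dvd hdvd)

open Polynomial in
theorem not_isGenuinelyPartiallyHyperbolic_and_isHigherRank {H : Type*} [Group H]
    [Group.IsNilpotent H] {N : ℕ} (hN : N ≤ 5 ∨ N = 7)
    (ρ : H →* Matrix.GeneralLinearGroup (Fin N) ℤ) :
    ¬ (IsGenuinelyPartiallyHyperbolic ρ ∧ IsHigherRank ρ) := by
  rintro ⟨hgph, _, ⟨A, rfl⟩, _, ⟨B, rfl⟩, herg⟩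
  obtain ⟨l, hl, hprod⟩ := exists_irreducibleRep_factors N (Fin N → ℚ) (rationalRep ρ) (by simp)
  have hdvd : ∀ s ∈ l, ∀ g, (s.2 g).charpoly ∣ (rationalRep ρ g).charpoly := by
    intro s hs g
    rw [hprod]
    exact List.dvd_prod (List.mem_map_of_mem hs)
  have hone : ∀ k : ℤ × ℤ, k ≠ 0 →
      (rationalRep ρ (A ^ k.1 * B ^ k.2)).charpoly.eval 1 ≠ 0 := by
    intro k hk
    refine eval_one_charpoly_rationalRep_ne_zero ?_
    rw [map_mul, map_zpow, map_zpow]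
    exact herg k hk
  obtain ⟨s, hs, e, he, he6, hes⟩ := exists_even_dvd_of_irreducibleRep_factors
    (A := A) (B := B) hl (fun s hs g => isIntegral_of_charpoly_dvd (hdvd s hs g))
    (fun k hk s hs h => hone k hk (eval_eq_zero_of_dvd_of_eval_eq_zero (hdvd s hs _) h))
    (fun g => by
      rw [← hprod]
      exact exists_isRoot_of_not_isHyperbolicElement (hgph.2 g))
  obtain ⟨q, hq⟩ := hdvd s hs A
  have hmonic := LinearMap.charpoly_monic (rationalRep ρ A)
  have hmonic' := LinearMap.charpoly_monic (s.2 A)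
  have hqm : q.Monic := hmonic'.of_mul_monic_left (hq ▸ hmonic)
  have hdeg := congrArg natDegree hq
  rw [hmonic'.natDegree_mul hqm, LinearMap.charpoly_natDegree, LinearMap.charpoly_natDegree,
    Module.finrank_fin_fun, Module.finrank_fin_fun] at hdeg
  have := (hl s hs).1
  have hspos : 0 < s.1 := by
    by_contra h0
    have h0 : s.1 = 0 := by omega
    have : IsEmpty (Fin s.1) := by rw [h0]; infer_instance
    exact not_subsingleton (Fin s.1 → ℚ) inferInstance
  have hle := Nat.le_of_dvd hspos hes
  have hN7 : N = 7 := by omega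
  have hs6 : s.1 = 6 := by
    obtain ⟨c, hc⟩ := hes
    obtain ⟨c', hc'⟩ := he
    have hc1 : c = 1 := by
      have : 0 < c := Nat.pos_of_ne_zero (by rintro rfl; omega)
      by_contra hne
      nlinarith [show 2 ≤ c by omega]
    subst hc1
    omega
  -- The factor of dimension 6 leaves a linear cofactor, so `A` has a rational eigenvalue and `A ^
  -- 2` has eigenvalue 1.
  have hq1 : q.natDegree = 1 := by omega
  obtain ⟨r, hr⟩ := exists_root_of_degree_eq_one
    ((degree_eq_iff_natDegree_eq_of_pos one_pos).mpr hq1)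
  have := eval_one_charpoly_sq_of_isRoot (hq ▸ hr.dvd (dvd_mul_left q _))
  refine hone (2, 0) (by simp) ?_
  simpa using this

/-! ### Actions by multiplication with units -/

/-- The action of `ℤ²` by multiplication with two units of an order, in a basis of the order. -/
noncomputable def unitsAction {R : Type*} [CommRing R] {N : ℕ} (e : Module.Basis (Fin N) ℤ R)
    (a b : Rˣ) : Multiplicative ℤ × Multiplicative ℤ →* Matrix.GeneralLinearGroup (Fin N) ℤ :=
  (Units.map (Algebra.leftMulMatrix e).toRingHom.toMonoidHom).comp
    ((zpowersHom Rˣ a).coprod (zpowersHom Rˣ b))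

theorem unitsAction_apply_val {R : Type*} [CommRing R] {N : ℕ} (e : Module.Basis (Fin N) ℤ R)
    (a b : Rˣ) (k : ℤ × ℤ) :
    (unitsAction e a b (Multiplicative.ofAdd k.1, Multiplicative.ofAdd k.2)).val =
      Algebra.leftMulMatrix e ((a ^ k.1 * b ^ k.2 : Rˣ) : R) := by
  change Algebra.leftMulMatrix e ((zpowersHom Rˣ a (Multiplicative.ofAdd k.1) *
    zpowersHom Rˣ b (Multiplicative.ofAdd k.2) : Rˣ) : R) = _
  rw [zpowersHom_apply, zpowersHom_apply]
  rfl

theorem det_leftMulMatrix_ne_zero {R : Type*} [CommRing R] {N : ℕ} (e : Module.Basis (Fin N) ℤ R)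
    {x : R} (hx : ∀ y, x * y = 0 → y = 0) : (Algebra.leftMulMatrix e x).det ≠ 0 := by
  intro h
  obtain ⟨v, hv, hvx⟩ := Matrix.exists_mulVec_eq_zero_iff.mpr h
  apply hv
  have h1 := Algebra.leftMulMatrix_mulVec_repr e x (e.equivFun.symm v)
  have h2 : ⇑(e.repr (e.equivFun.symm v)) = v := e.equivFun.apply_symm_apply v
  rw [h2, hvx] at h1
  have h3 : x * e.equivFun.symm v = 0 := by
    apply e.repr.injective
    ext i
    rw [← congrFun h1 i]
    simp
  exact e.equivFun.symm.map_eq_zero_iff.mp (hx _ h3)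

theorem isErgodicElement_unitsAction {R : Type*} [CommRing R] {N : ℕ}
    (e : Module.Basis (Fin N) ℤ R) {a b : Rˣ}
    (hreg : ∀ k : ℤ × ℤ, k ≠ 0 → ∀ y, (((a ^ k.1 * b ^ k.2 : Rˣ) : R) - 1) * y = 0 → y = 0)
    {k : ℤ × ℤ} (hk : k ≠ 0) :
    IsErgodicElement (unitsAction e a b (Multiplicative.ofAdd k.1, Multiplicative.ofAdd k.2)) := by
  refine ergodic_toralMap fun n hn => ?_
  rw [unitsAction_apply_val, ← map_pow, ← map_one (Algebra.leftMulMatrix e), ← map_sub]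
  refine det_leftMulMatrix_ne_zero e fun y hy => ?_
  refine hreg (k.1 * n, k.2 * n) (fun h => hk ?_) y ?_
  · simp only [Prod.mk_eq_zero, mul_eq_zero, Nat.cast_eq_zero, hn.ne', or_false] at h
    exact Prod.ext h.1 h.2
  · rw [← hy, ← Units.val_pow_eq_pow_val, mul_pow, ← zpow_natCast, ← zpow_natCast, ← zpow_mul,
      ← zpow_mul]

theorem not_isHyperbolicElement_unitsAction {R : Type*} [CommRing R] {N : ℕ}
    (e : Module.Basis (Fin N) ℤ R) {a b : Rˣ} {φ : R →+* ℂ} (ha : ‖φ a‖ = 1) (hb : ‖φ b‖ = 1)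
    (h : Multiplicative ℤ × Multiplicative ℤ) : ¬ IsHyperbolicElement (unitsAction e a b h) := by
  intro hyp
  set k : ℤ × ℤ := (h.1.toAdd, h.2.toAdd)
  have hval := unitsAction_apply_val e a b k
  change (unitsAction e a b h).val = _ at hval
  set x : Rˣ := a ^ k.1 * b ^ k.2
  have hx : ‖φ x‖ = 1 := by
    have h1 : Units.map φ.toMonoidHom x =
        Units.map φ.toMonoidHom a ^ k.1 * Units.map φ.toMonoidHom b ^ k.2 := by
      rw [map_mul, map_zpow, map_zpow]
    have h2 : φ x = φ a ^ k.1 * φ b ^ k.2 := by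
      simpa using congrArg Units.val h1
    rw [h2, norm_mul, norm_zpow, norm_zpow, ha, hb, one_zpow, one_zpow, one_mul]
  refine hyp (φ x) ?_ hx
  rw [hval, Matrix.mem_spectrum_iff_isRoot_charpoly, Polynomial.IsRoot, Matrix.eval_charpoly,
    ← Matrix.exists_vecMul_eq_zero_iff]
  -- The images of the basis form a left eigenvector with eigenvalue `φ x`, nonzero because `1` is a
  -- combination of the basis.
  refine ⟨fun j => φ (e j), fun h0 => ?_, ?_⟩
  · have h1 := congrArg φ (e.sum_repr 1)
    rw [map_sum, φ.map_one] at h1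
    simp only [zsmul_eq_mul, φ.map_mul] at h1
    refine one_ne_zero (h1.symm.trans (Finset.sum_eq_zero fun i _ => ?_))
    rw [show φ (e i) = 0 from congrFun h0 i, mul_zero]
  · rw [Matrix.vecMul_sub, sub_eq_zero]
    funext j
    have h1 := congrArg φ (e.sum_repr ((x : R) * e j))
    rw [map_sum, φ.map_mul] at h1
    simp only [zsmul_eq_mul, φ.map_mul, map_intCast] at h1
    rw [Matrix.scalar_apply]
    refine (Matrix.vecMul_diagonal _ _ _).trans ?_
    simp only [Matrix.vecMul, dotProduct, Matrix.map_apply, Algebra.leftMulMatrix_eq_repr_mul]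
    rw [mul_comm, ← h1]
    exact Finset.sum_congr rfl fun i _ => mul_comm _ _

/-- Independence is phrased as regularity of `a ^ k.1 * b ^ k.2 - 1` because `R` will also be a
product of two rings of integers. -/
theorem unitsAction_properties {R : Type*} [CommRing R] {N : ℕ}
    (e : Module.Basis (Fin N) ℤ R) {a b : Rˣ}
    (hreg : ∀ k : ℤ × ℤ, k ≠ 0 → ∀ y, (((a ^ k.1 * b ^ k.2 : Rˣ) : R) - 1) * y = 0 → y = 0)
    {φ : R →+* ℂ} (ha : ‖φ a‖ = 1) (hb : ‖φ b‖ = 1) :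
    Function.Injective (unitsAction e a b) ∧ IsGenuinelyPartiallyHyperbolic (unitsAction e a b) ∧
      IsHigherRank (unitsAction e a b) := by
  refine ⟨?_, ⟨?_, not_isHyperbolicElement_unitsAction e ha hb⟩, ?_⟩
  · have := φ.domain_nontrivial
    rw [injective_iff_map_eq_one]
    intro h h1
    by_contra hne
    set k : ℤ × ℤ := (h.1.toAdd, h.2.toAdd)
    have hval := unitsAction_apply_val e a b k
    change (unitsAction e a b h).val = _ at hval
    rw [h1, Units.val_one, ← map_one (Algebra.leftMulMatrix e)] at hval
    have h2 := Algebra.leftMulMatrix_injective e hval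
    refine one_ne_zero (hreg k (fun h0 => hne ?_) 1 (by rw [← h2, sub_self, zero_mul]))
    exact Prod.ext (congrArg Prod.fst h0) (congrArg Prod.snd h0)
  · exact isErgodicAction_of_isErgodicElement _
      (isErgodicElement_unitsAction e hreg (k := (1, 0)) (by simp))
  · refine ⟨_, ⟨(Multiplicative.ofAdd 1, Multiplicative.ofAdd 0), rfl⟩,
      _, ⟨(Multiplicative.ofAdd 0, Multiplicative.ofAdd 1), rfl⟩, fun k hk => ?_⟩
    have h1 := isErgodicElement_unitsAction e hreg hk
    rw [← map_zpow, ← map_zpow, ← map_mul]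
    convert! h1 using 2
    simp [← ofAdd_zsmul]

-- An invariant subspace is stable under `ℚ(a) = K`, hence is a `K`-subspace of the line `K`.
open NumberField IntermediateField in
theorem isIrreducibleAction_unitsAction {K : Type*} [Field K] [NumberField K] {N : ℕ}
    (e : Module.Basis (Fin N) ℤ (𝓞 K)) {a b : (𝓞 K)ˣ} (ha : ℚ⟮(a : K)⟯ = ⊤) :
    IsIrreducibleAction (unitsAction e a b) := by
  intro W hW
  set eQ := e.localizationLocalization ℚ (nonZeroDivisors ℤ) K with heQ
  have hmul : ∀ y : K, eQ.equivFun y ∈ W → eQ.equivFun ((a : K) * y) ∈ W := by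
    intro y hy
    have h1 := hW (Multiplicative.ofAdd 1, Multiplicative.ofAdd 0) _ hy
    have h2 := unitsAction_apply_val e a b (1, 0)
    dsimp only at h2
    rw [h2, zpow_one, zpow_zero, mul_one] at h1
    have h3 := Algebra.map_leftMulMatrix_localization ℤ (Rₘ := ℚ) (Sₘ := K)
      (nonZeroDivisors ℤ) e a.val
    rw [RingHom.mapMatrix_apply, algebraMap_int_eq] at h3
    change (Algebra.leftMulMatrix e a.val).map (Int.castRingHom ℚ) *ᵥ _ ∈ W at h1
    rw [h3] at h1
    have h4 := Algebra.leftMulMatrix_mulVec_repr eQ (a : K) y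
    rw [Module.Basis.equivFun_apply, ← h4]
    exact h1
  have hall : ∀ x y : K, eQ.equivFun y ∈ W → eQ.equivFun (x * y) ∈ W := by
    intro x
    have hx : x ∈ Algebra.adjoin ℚ {(a : K)} := by
      rw [← adjoin_simple_toSubalgebra_of_isAlgebraic (Algebra.IsAlgebraic.isAlgebraic _), ha]
      exact mem_top
    induction hx using Algebra.adjoin_induction with
    | mem x hx =>
      rw [Set.mem_singleton_iff] at hx
      exact hx ▸ hmul
    | algebraMap r =>
      intro y hy
      rw [← Algebra.smul_def, map_smul]
      exact W.smul_mem r hy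
    | add x y _ _ hx hy =>
      intro z hz
      rw [add_mul, map_add]
      exact W.add_mem (hx z hz) (hy z hz)
    | mul x y _ _ hx hy =>
      intro z hz
      rw [mul_assoc]
      exact hx _ (hy z hz)
  rw [or_iff_not_imp_left]
  intro hbot
  obtain ⟨w, hw, hw0⟩ := W.ne_bot_iff.mp hbot
  rw [Submodule.eq_top_iff']
  intro v
  have hy : eQ.equivFun.symm w ≠ 0 := eQ.equivFun.symm.map_ne_zero_iff.mpr hw0
  have h1 := hall (eQ.equivFun.symm v * (eQ.equivFun.symm w)⁻¹) (eQ.equivFun.symm w)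
    (by rwa [LinearEquiv.apply_symm_apply])
  rwa [inv_mul_cancel_right₀ hy, LinearEquiv.apply_symm_apply] at h1

/-! ### The polynomials `X ^ N - 6 X ^ k + 2` and their roots -/

open Polynomial in
theorem irreducible_X_pow_sub_six_mul_X_pow_add_two {N k : ℕ} (hk : 0 < k) (hkN : k < N) :
    Irreducible (X ^ N - 6 * X ^ k + 2 : ℚ[X]) := by
  set f : ℤ[X] := X ^ N - 6 * X ^ k + 2 with hf
  have hdeg : f.natDegree = N := by
    rw [hf]
    compute_degree!
    · rw [if_neg (by omega), if_neg (by omega)]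
      simp
    all_goals omega
  have hcoeff : ∀ i, f.coeff i = (if i = N then 1 else 0) - 6 * (if i = k then 1 else 0) +
      if i = 0 then 2 else 0 := by
    intro i
    rw [hf, coeff_add, coeff_sub, coeff_X_pow, coeff_ofNat_mul, coeff_X_pow,
      ← map_ofNat C 2, coeff_C]
  have hmonic : f.Monic := by
    rw [Monic, leadingCoeff, hdeg, hcoeff, if_pos rfl, if_neg (by omega), if_neg (by omega)]
    norm_num
  have hprime : (Ideal.span {(2 : ℤ)}).IsPrime :=
    (Ideal.span_singleton_prime two_ne_zero).mpr Int.prime_two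
  have hirr : Irreducible f := by
    refine IsEisensteinAt.irreducible (𝓟 := Ideal.span {(2 : ℤ)}) ⟨?_, ?_, ?_⟩ hprime
      hmonic.isPrimitive (by omega)
    · rw [hmonic.leadingCoeff, Ideal.mem_span_singleton]
      norm_num
    · intro i hi
      rw [hdeg] at hi
      rw [Ideal.mem_span_singleton, hcoeff, if_neg hi.ne]
      split_ifs <;> norm_num
    · rw [hcoeff, if_neg (by omega), if_neg (by omega), if_pos rfl, Ideal.span_singleton_pow,
        Ideal.mem_span_singleton]
      norm_num
  have h1 := (hmonic.irreducible_iff_irreducible_map_fraction_map (K := ℚ)).mp hirr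
  simpa [hf] using h1

open Polynomial in
/-- The number field generated by a root of the Eisenstein polynomial `X ^ N - 6 X ^ k + 2`. -/
theorem exists_numberField_root {N k : ℕ} (hk : 0 < k) (hkN : k < N) :
    ∃ (K : Type) (_ : Field K) (_ : NumberField K) (θ : K), Module.finrank ℚ K = N ∧
      θ ^ N - 6 * θ ^ k + 2 = 0 ∧
      ∀ (L : Type) [Field L] [CharZero L],
        (∀ z : L, z ^ N - 6 * z ^ k + 2 = 0 → ∃ φ : K →+* L, φ θ = z) ∧
          ∀ φ ψ : K →+* L, φ θ = ψ θ → φ = ψ := by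
  have hirr := irreducible_X_pow_sub_six_mul_X_pow_add_two hk hkN
  set f : ℚ[X] := X ^ N - 6 * X ^ k + 2 with hf
  have hdeg : f.natDegree = N := by
    rw [hf]
    compute_degree!
    · rw [if_neg (by omega), if_neg (by omega)]
      simp
    all_goals omega
  have : Fact (Irreducible f) := ⟨hirr⟩
  refine ⟨AdjoinRoot f, inferInstance, inferInstance, AdjoinRoot.root f, ?_, ?_, ?_⟩
  · have h1 := (AdjoinRoot.powerBasis hirr.ne_zero).finrank
    rw [AdjoinRoot.powerBasis_dim, hdeg] at h1
    rw [← h1]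
  · have h1 := AdjoinRoot.eval₂_root f
    simpa [hf] using h1
  · intro L _ _
    refine ⟨fun z hz => ⟨AdjoinRoot.lift (algebraMap ℚ L) z (by simpa [hf] using hz),
      AdjoinRoot.lift_root _⟩, fun φ ψ h => ?_⟩
    have h1 : φ.comp (AdjoinRoot.of f) = ψ.comp (AdjoinRoot.of f) := Subsingleton.elim _ _
    refine RingHom.ext fun x => ?_
    induction x using AdjoinRoot.induction_on with
    | ih p =>
      induction p using Polynomial.induction_on' with
      | add p q hp hq => rw [map_add, map_add, map_add, hp, hq]
      | monomial n r =>
        rw [← C_mul_X_pow_eq_monomial, map_mul, map_pow, AdjoinRoot.mk_X, AdjoinRoot.mk_C,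
          map_mul, map_mul, map_pow, map_pow, h]
        exact congrArg (· * _) (RingHom.congr_fun h1 r)

theorem exists_mem_Ioo_root {N k : ℕ} (hk : 0 < k) (hkN : k + 2 ≤ N) :
    (∃ s ∈ Set.Ioo (0 : ℝ) 1, s ^ N - 6 * s ^ k + 2 = 0) ∧
      ∃ s ∈ Set.Ioo (1 : ℝ) 3, s ^ N - 6 * s ^ k + 2 = 0 := by
  have hcont : Continuous fun s : ℝ => s ^ N - 6 * s ^ k + 2 := by fun_prop
  constructor
  · refine intermediate_value_Ioo' zero_le_one hcont.continuousOn ⟨?_, ?_⟩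
    · norm_num
    · rw [zero_pow (by omega), zero_pow hk.ne']
      norm_num
  · refine intermediate_value_Ioo (by norm_num : (1 : ℝ) ≤ 3) hcont.continuousOn ⟨?_, ?_⟩
    · norm_num
    · obtain ⟨c, rfl⟩ := Nat.exists_eq_add_of_le hkN
      have h1 : (1 : ℝ) ≤ 3 ^ k := one_le_pow₀ (by norm_num)
      have h2 : (1 : ℝ) ≤ 3 ^ c := one_le_pow₀ (by norm_num)
      have h3 : (1 : ℝ) ≤ 3 ^ k * 3 ^ c := one_le_mul_of_one_le_of_one_le h1 h2
      have h4 : (3 : ℝ) ^ k ≤ 3 ^ k * 3 ^ c := le_mul_of_one_le_right (by positivity) h2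
      have h5 : (3 : ℝ) ^ (k + 2 + c) = 9 * (3 ^ k * 3 ^ c) := by ring
      rw [h5]
      linarith

theorem exists_imaginary_root (j : ℕ) : ∃ y : ℝ,
    (y * Complex.I) ^ (2 * j + 4) - 6 * (y * Complex.I) ^ (2 * j) + 2 = 0 := by
  have hcont : Continuous fun y : ℝ => (-1) ^ j * y ^ (2 * j) * (y ^ 4 - 6) + 2 := by fun_prop
  have h1 : ∃ y : ℝ, (-1) ^ j * y ^ (2 * j) * (y ^ 4 - 6) + 2 = 0 := by
    -- At `y ^ 4 = 6` the value is 2; a nonpositive value occurs at `y = 1` for even `j` and at `y =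
    -- 2` for odd `j`.
    refine mem_range_of_exists_le_of_exists_ge hcont ?_ ⟨(6 : ℝ) ^ (1 / 4 : ℝ), ?_⟩
    · rcases Nat.even_or_odd j with hj | hj
      · exact ⟨1, by norm_num [hj.neg_one_pow]⟩
      · refine ⟨2, ?_⟩
        have : (1 : ℝ) ≤ 2 ^ (2 * j) := one_le_pow₀ (by norm_num)
        rw [hj.neg_one_pow]
        linarith
    · rw [← Real.rpow_natCast (6 ^ (1 / 4 : ℝ)) 4, ← Real.rpow_mul (by norm_num)]
      norm_num
  obtain ⟨y, hy⟩ := h1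
  refine ⟨y, ?_⟩
  have h2 : (Complex.I : ℂ) ^ (2 * j) = (-1) ^ j := by rw [pow_mul, Complex.I_sq]
  have h3 : ((y * Complex.I : ℂ)) ^ (2 * j + 4) - 6 * (y * Complex.I) ^ (2 * j) + 2 =
      (((-1) ^ j * y ^ (2 * j) * (y ^ 4 - 6) + 2 : ℝ) : ℂ) := by
    rw [pow_add, mul_pow, mul_pow, h2, Complex.I_pow_four]
    push_cast
    ring
  rw [h3, hy, Complex.ofReal_zero]

/-! ### Dominant units and their independence -/

open NumberField in
/-- A unit all of whose conjugates except a given real one lie inside the unit circle. -/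
theorem exists_unit_dominant {K : Type*} [Field K] [NumberField K] {φ : K →+* ℂ}
    (hφ : (starRingEnd ℂ).comp φ = φ) :
    ∃ ε : (𝓞 K)ˣ, (∀ ψ : K →+* ℂ, ψ ≠ φ → Real.log ‖ψ ε‖ < 0) ∧
      ∀ ψ ψ' : K →+* ℂ, ψ ≠ φ → ψ' ≠ φ → ψ ≠ ψ' →
        -Real.log ‖ψ ε‖ - Real.log ‖ψ' ε‖ ≤ Real.log ‖φ ε‖ := by
  classical
  obtain ⟨ε, hε⟩ := Units.dirichletUnitTheorem.exists_unit K (InfinitePlace.mk φ)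
  have hneg : ∀ ψ : K →+* ℂ, ψ ≠ φ → Real.log ‖ψ ε‖ < 0 := by
    intro ψ hψ
    refine hε (InfinitePlace.mk ψ) fun h => hψ ?_
    -- Embeddings with the same place are equal or conjugate, and `φ` is its own conjugate.
    rcases InfinitePlace.mk_eq_iff.mp h with h | h
    · exact h
    · rw [← hφ, ← h]
      ext x
      simp [ComplexEmbedding.conjugate]
  refine ⟨ε, hneg, fun ψ ψ' hψ hψ' hne => ?_⟩
  have hsum := Units.sum_log_norm_embedding ε
  rw [← Finset.add_sum_erase _ _ (Finset.mem_univ φ),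
    ← Finset.add_sum_erase (Finset.univ.erase φ) _ (a := ψ) (by simp [hψ]),
    ← Finset.add_sum_erase ((Finset.univ.erase φ).erase ψ) _ (a := ψ')
      (by simp [hψ', hne.symm])] at hsum
  have h1 : ∑ χ ∈ ((Finset.univ.erase φ).erase ψ).erase ψ', Real.log ‖χ ε‖ ≤ 0 :=
    Finset.sum_nonpos fun χ hχ => (hneg χ (by simp at hχ; exact hχ.2.2)).le
  linarith

-- The 2 × 2 matrix of logarithms at `φ` and `ψ` is strictly diagonally dominant, hence nonsingular.
open NumberField in
theorem zpow_mul_zpow_ne_one_of_dominant {K : Type*} [Field K] [NumberField K] {φ ψ : K →+* ℂ}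
    {a b : (𝓞 K)ˣ} (ha : |Real.log ‖ψ a‖| < Real.log ‖φ a‖)
    (hb : |Real.log ‖φ b‖| < Real.log ‖ψ b‖) {k : ℤ × ℤ} (hk : k ≠ 0) :
    a ^ k.1 * b ^ k.2 ≠ 1 := by
  intro h
  have h1 := Units.log_norm_zpow_mul_zpow φ a b k.1 k.2
  have h2 := Units.log_norm_zpow_mul_zpow ψ a b k.1 k.2
  rw [h] at h1 h2
  simp only [Units.coe_one, map_one, norm_one, Real.log_one] at h1 h2
  have h3 : |(k.1 : ℝ)| * Real.log ‖φ a‖ = |(k.2 : ℝ)| * |Real.log ‖φ b‖| := by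
    rw [← abs_of_pos ((abs_nonneg _).trans_lt ha), ← abs_mul, ← abs_mul,
      eq_neg_of_add_eq_zero_left h1.symm, abs_neg]
  have h4 : |(k.2 : ℝ)| * Real.log ‖ψ b‖ = |(k.1 : ℝ)| * |Real.log ‖ψ a‖| := by
    rw [← abs_of_pos ((abs_nonneg _).trans_lt hb), ← abs_mul, ← abs_mul,
      eq_neg_of_add_eq_zero_right h2.symm, abs_neg]
  have h5 : k.1 = 0 := by
    by_contra hne
    have h6 : 0 < |(k.1 : ℝ)| := by positivity
    have h7 := mul_lt_mul_of_pos_left ha h6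
    have h8 := mul_le_mul_of_nonneg_left hb.le (abs_nonneg (k.2 : ℝ))
    linarith
  rw [h5, Int.cast_zero, abs_zero, zero_mul] at h4
  have h6 : |(k.2 : ℝ)| = 0 :=
    (mul_eq_zero.mp h4).resolve_right ((abs_nonneg _).trans_lt hb).ne'
  rw [abs_eq_zero, Int.cast_eq_zero] at h6
  exact hk (Prod.ext h5 h6)

theorem conj_comp_eq_of_real {K : Type} [Field K] {θ : K}
    (hext : ∀ φ ψ : K →+* ℂ, φ θ = ψ θ → φ = ψ) {φ : K →+* ℂ} {r : ℝ} (h : φ θ = r) :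
    (starRingEnd ℂ).comp φ = φ :=
  hext _ _ (by simp [h])

open NumberField IntermediateField ComplexConjugate in
/-- In a field with an involution `τ`, the quotient `ε / τ ε` for a unit `ε` dominant at the real
embedding `φ`. -/
theorem exists_relative_unit_dominant {K : Type} [Field K] [NumberField K] {φ : K →+* ℂ}
    (hφ : (starRingEnd ℂ).comp φ = φ) {τ : K →+* K} (hττ : τ.comp τ = RingHom.id K)
    (hτ : ∀ ψ : K →+* ℂ, ψ.comp τ ≠ ψ) :
    ∃ a : (𝓞 K)ˣ, 0 < Real.log ‖φ a‖ ∧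
      (∀ ψ : K →+* ℂ, ψ ≠ φ → ψ ≠ φ.comp τ → |Real.log ‖ψ a‖| < Real.log ‖φ a‖) ∧
      ℚ⟮(a : K)⟯ = ⊤ ∧
      ∀ ψ : K →+* ℂ, ψ.comp τ = (starRingEnd ℂ).comp ψ → ‖ψ a‖ = 1 := by
  obtain ⟨ε, hneg, hpair⟩ := exists_unit_dominant hφ
  set ε' : (𝓞 K)ˣ := Units.map (RingOfIntegers.mapRingHom τ).toMonoidHom ε with hε'
  have hε'K : (ε' : K) = τ ε := rfl
  have hcoe : ∀ ψ : K →+* ℂ, ψ ((ε * ε'⁻¹ : (𝓞 K)ˣ) : K) = ψ ε / ψ.comp τ ε := by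
    intro ψ
    rw [NumberField.Units.coe_mul, ← zpow_neg_one ε', NumberField.Units.coe_zpow, zpow_neg_one,
      map_mul, map_inv₀, hε'K, RingHom.comp_apply, div_eq_mul_inv]
  have hne : ∀ ψ : K →+* ℂ, ‖ψ ε‖ ≠ 0 := fun ψ => by simp
  have hlog : ∀ ψ : K →+* ℂ, Real.log ‖ψ ((ε * ε'⁻¹ : (𝓞 K)ˣ) : K)‖ =
      Real.log ‖ψ ε‖ - Real.log ‖ψ.comp τ ε‖ := by
    intro ψ
    rw [hcoe, norm_div, Real.log_div (hne _) (hne _)]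
  have hinv : ∀ ψ : K →+* ℂ, (ψ.comp τ).comp τ = ψ := fun ψ => by
    rw [RingHom.comp_assoc, hττ, RingHom.comp_id]
  have hφτ := hneg _ (hτ φ)
  have hdom : ∀ ψ : K →+* ℂ, ψ ≠ φ → ψ ≠ φ.comp τ →
      |Real.log ‖ψ ((ε * ε'⁻¹ : (𝓞 K)ˣ) : K)‖| <
        Real.log ‖φ ((ε * ε'⁻¹ : (𝓞 K)ˣ) : K)‖ := by
    intro ψ h1 h2
    have h3 : ψ.comp τ ≠ φ := fun h => h2 (by rw [← h, hinv])
    -- A difference of two negative logarithms is smaller in absolute value than minus their sum,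
    -- which `hpair` bounds by `log ‖φ ε‖`.
    have h4 := hpair ψ (ψ.comp τ) h1 h3 (hτ ψ).symm
    have h5 := hneg _ h1
    have h6 := hneg _ h3
    rw [hlog, hlog, abs_lt]
    constructor <;> linarith
  have hpos : 0 < Real.log ‖φ ((ε * ε'⁻¹ : (𝓞 K)ˣ) : K)‖ := by
    rw [hlog]
    have h1 : 0 ≤ Real.log ‖φ ε‖ := by
      have h2 := NumberField.Units.sum_log_norm_embedding ε
      by_contra hlt
      rw [not_le] at hlt
      refine (Finset.sum_neg (s := Finset.univ) (fun ψ _ => ?_) ⟨φ, Finset.mem_univ φ⟩).ne h2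
      by_cases h : ψ = φ
      · exact h ▸ hlt
      · exact hneg ψ h
    linarith
  refine ⟨ε * ε'⁻¹, hpos, hdom, ?_, fun ψ hψ => ?_⟩
  -- No other embedding agrees with `φ` at the quotient: at `φ.comp τ` the logarithm changes sign,
  -- elsewhere it is strictly smaller.
  · rw [Field.primitive_element_iff_algHom_eq_of_eval ℚ ℂ (fun _ => IsAlgClosed.splits _) _
      φ.toRatAlgHom]
    intro ψ hψ
    have hψ' : φ ((ε * ε'⁻¹ : (𝓞 K)ˣ) : K) = ψ.toRingHom ((ε * ε'⁻¹ : (𝓞 K)ˣ) : K) := hψ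
    by_contra hne'
    have h1 : ψ.toRingHom ≠ φ := fun h => hne' (AlgHom.ext fun x => (RingHom.congr_fun h x).symm)
    by_cases h2 : ψ.toRingHom = φ.comp τ
    · have h3 := hlog ψ.toRingHom
      rw [← hψ', h2, hinv] at h3
      rw [hlog] at h3 hpos
      linarith
    · have h3 := hdom _ h1 h2
      rw [← hψ'] at h3
      exact absurd (le_abs_self _) (not_le.mpr h3)
  · rw [hcoe, hψ, norm_div, RingHom.comp_apply, RCLike.norm_conj, div_self (hne _)]

/-! ### Construction of the examples -/

open NumberField IntermediateField in
theorem exists_units_of_even {N : ℕ} (hN : 6 ≤ N) (heven : Even N) :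
    ∃ (K : Type) (_ : Field K) (_ : NumberField K) (a b : (𝓞 K)ˣ) (φ : K →+* ℂ),
      Module.finrank ℚ K = N ∧ ℚ⟮(a : K)⟯ = ⊤ ∧ ‖φ a‖ = 1 ∧ ‖φ b‖ = 1 ∧
        ∀ k : ℤ × ℤ, k ≠ 0 → a ^ k.1 * b ^ k.2 ≠ 1 := by
  obtain ⟨j, hj⟩ : ∃ j, N = 2 * j + 4 := by
    obtain ⟨c, hc⟩ := heven
    exact ⟨c - 2, by omega⟩
  have hj0 : 0 < 2 * j := by omega
  obtain ⟨K, _, _, θ, hfin, hθ, hK⟩ := exists_numberField_root hj0 (show 2 * j < N by omega)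
  obtain ⟨hC, hCext⟩ := hK ℂ
  obtain ⟨hKK, hKext⟩ := hK K
  obtain ⟨τ, hτ⟩ := hKK (-θ) (by rw [heven.neg_pow, (even_two_mul j).neg_pow, hθ])
  obtain ⟨⟨s₁, hs₁, hs₁'⟩, s₂, hs₂, hs₂'⟩ :=
    exists_mem_Ioo_root hj0 (show 2 * j + 2 ≤ N by omega)
  obtain ⟨y, hy⟩ := exists_imaginary_root j
  rw [← hj] at hy
  obtain ⟨φ₁, hφ₁⟩ := hC s₁ (by exact_mod_cast hs₁')
  obtain ⟨φ₂, hφ₂⟩ := hC s₂ (by exact_mod_cast hs₂')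
  obtain ⟨φ₃, hφ₃⟩ := hC _ hy
  have hθ0 : θ ≠ 0 := by
    rintro rfl
    rw [zero_pow (by omega), zero_pow hj0.ne'] at hθ
    norm_num at hθ
  have hττ : τ.comp τ = RingHom.id K := hKext _ _ (by simp [hτ])
  have hτψ : ∀ ψ : K →+* ℂ, ψ.comp τ ≠ ψ := by
    intro ψ h
    have h1 := RingHom.congr_fun h θ
    rw [RingHom.comp_apply, hτ, map_neg, neg_eq_self, map_eq_zero] at h1
    exact hθ0 h1
  have hφ₃τ : φ₃.comp τ = (starRingEnd ℂ).comp φ₃ := hCext _ _ (by simp [hτ, hφ₃])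
  obtain ⟨a, hapos, hadom, haprim, ha⟩ :=
    exists_relative_unit_dominant (conj_comp_eq_of_real hCext hφ₁) hττ hτψ
  obtain ⟨b, hbpos, hbdom, -, hb⟩ :=
    exists_relative_unit_dominant (conj_comp_eq_of_real hCext hφ₂) hττ hτψ
  have hne : ∀ {φ ψ : K →+* ℂ} {r t : ℝ}, φ θ = r → ψ θ = t → r ≠ t → r ≠ -t →
      φ ≠ ψ ∧ φ ≠ ψ.comp τ := by
    intro φ ψ r t h1 h2 h3 h4
    constructor
    · rintro rfl
      exact h3 (by exact_mod_cast h1.symm.trans h2)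
    · rintro rfl
      rw [RingHom.comp_apply, hτ, map_neg, h2] at h1
      exact h4 (by exact_mod_cast h1.symm)
  simp only [Set.mem_Ioo] at hs₁ hs₂
  obtain ⟨h₁₂, h₁₂'⟩ := hne hφ₁ hφ₂ (by linarith) (by linarith)
  obtain ⟨h₂₁, h₂₁'⟩ := hne hφ₂ hφ₁ (by linarith) (by linarith)
  exact ⟨K, inferInstance, inferInstance, a, b, φ₃, hfin, haprim, ha φ₃ hφ₃τ, hb φ₃ hφ₃τ,
    -- The roots `s₁ < 1 < s₂` are neither equal nor opposite, so each of `φ₁`, `φ₂` lies off the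
    -- `τ`-orbit of the other, where dominance is strict.
    fun k hk => zpow_mul_zpow_ne_one_of_dominant (hadom φ₂ h₂₁ h₂₁') (hbdom φ₁ h₁₂ h₁₂') hk⟩

-- The polynomial `X ^ 3 - 6 X + 2` has three real roots. The negative logarithm at the third
-- embedding makes the dominance at the first two strict.
open NumberField in
theorem exists_cubic_units :
    ∃ (K : Type) (_ : Field K) (_ : NumberField K) (a b : (𝓞 K)ˣ),
      Module.finrank ℚ K = 3 ∧ ∀ k : ℤ × ℤ, k ≠ 0 → a ^ k.1 * b ^ k.2 ≠ 1 := by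
  obtain ⟨K, _, _, θ, hfin, -, hK⟩ := exists_numberField_root one_pos (show 1 < 3 by omega)
  obtain ⟨hC, hCext⟩ := hK ℂ
  obtain ⟨⟨s₁, hs₁, hs₁'⟩, s₂, hs₂, hs₂'⟩ := exists_mem_Ioo_root one_pos (show 1 + 2 ≤ 3 by omega)
  obtain ⟨s₃, hs₃, hs₃'⟩ : ∃ s ∈ Set.Ioo (-3 : ℝ) 0, s ^ 3 - 6 * s ^ 1 + 2 = 0 := by
    refine intermediate_value_Ioo (by norm_num) (by fun_prop) ⟨?_, ?_⟩ <;> norm_num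
  obtain ⟨φ₁, hφ₁⟩ := hC s₁ (by exact_mod_cast hs₁')
  obtain ⟨φ₂, hφ₂⟩ := hC s₂ (by exact_mod_cast hs₂')
  obtain ⟨φ₃, hφ₃⟩ := hC s₃ (by exact_mod_cast hs₃')
  obtain ⟨a, haneg, hapair⟩ := exists_unit_dominant (conj_comp_eq_of_real hCext hφ₁)
  obtain ⟨b, hbneg, hbpair⟩ := exists_unit_dominant (conj_comp_eq_of_real hCext hφ₂)
  have hne : ∀ {φ ψ : K →+* ℂ} {r t : ℝ}, φ θ = r → ψ θ = t → r ≠ t → φ ≠ ψ := by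
    rintro φ ψ r t h1 h2 h3 rfl
    exact h3 (by exact_mod_cast h1.symm.trans h2)
  simp only [Set.mem_Ioo] at hs₁ hs₂ hs₃
  have h₁₂ := hne hφ₁ hφ₂ (by linarith)
  have h₃₁ := hne hφ₃ hφ₁ (by linarith)
  have h₃₂ := hne hφ₃ hφ₂ (by linarith)
  refine ⟨K, inferInstance, inferInstance, a, b, hfin,
    fun k hk => zpow_mul_zpow_ne_one_of_dominant (φ := φ₁) (ψ := φ₂) ?_ ?_ hk⟩
  · have h1 := hapair φ₂ φ₃ h₁₂.symm h₃₁ h₃₂.symm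
    have h2 := haneg φ₃ h₃₁
    rw [abs_of_neg (haneg φ₂ h₁₂.symm)]
    linarith
  · have h1 := hbpair φ₁ φ₃ h₁₂ h₃₂ h₃₁.symm
    have h2 := hbneg φ₃ h₃₂
    rw [abs_of_neg (hbneg φ₁ h₁₂)]
    linarith

theorem eq_zero_of_units_sub_one_mul_eq_zero {R : Type*} [CommRing R] [IsDomain R] {u : Rˣ}
    (hu : u ≠ 1) {y : R} (hy : ((u : R) - 1) * y = 0) : y = 0 :=
  (mul_eq_zero.mp hy).resolve_left fun h => hu (Units.ext (sub_eq_zero.mp h))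

open NumberField in
theorem exists_irreducible_action_of_even {N : ℕ} (hN : 6 ≤ N) (heven : Even N) :
    ∃ (H : Type) (_ : Group H) (_ : Group.FG H) (_ : Group.IsNilpotent H)
      (ρ : H →* Matrix.GeneralLinearGroup (Fin N) ℤ),
      Function.Injective ρ ∧ IsGenuinelyPartiallyHyperbolic ρ ∧ IsHigherRank ρ ∧
        IsIrreducibleAction ρ := by
  obtain ⟨K, _, _, a, b, φ, hfin, hprim, ha, hb, hab⟩ := exists_units_of_even hN heven
  let e : Module.Basis (Fin N) ℤ (𝓞 K) :=
    Module.finBasisOfFinrankEq ℤ (𝓞 K) ((RingOfIntegers.rank K).trans hfin)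
  obtain ⟨h1, h2, h3⟩ := unitsAction_properties e (a := a) (b := b)
    (fun k hk y hy => eq_zero_of_units_sub_one_mul_eq_zero (hab k hk) hy)
    (φ := φ.comp (algebraMap (𝓞 K) K)) ha hb
  exact ⟨_, inferInstance, inferInstance, inferInstance, unitsAction e a b, h1, h2, h3,
    isIrreducibleAction_unitsAction e hprim⟩

open NumberField in
theorem exists_action_of_odd {N : ℕ} (hN : 9 ≤ N) (hodd : Odd N) :
    ∃ (H : Type) (_ : Group H) (_ : Group.FG H) (_ : Group.IsNilpotent H)
      (ρ : H →* Matrix.GeneralLinearGroup (Fin N) ℤ),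
      Function.Injective ρ ∧ IsGenuinelyPartiallyHyperbolic ρ ∧ IsHigherRank ρ := by
  obtain ⟨M, rfl⟩ := Nat.exists_eq_add_of_le' (show 3 ≤ N by omega)
  have heven : Even M := by
    rw [Nat.odd_add] at hodd
    by_contra h
    have := hodd.mp (Nat.not_even_iff_odd.mp h)
    exact absurd this (by decide)
  obtain ⟨K, _, _, a, b, φ, hfin, -, ha, hb, hab⟩ :=
    exists_units_of_even (show 6 ≤ M by omega) heven
  obtain ⟨L, _, _, a', b', hfin', hab'⟩ := exists_cubic_units
  -- The even-degree factor supplies the modulus-one embedding; the cubic one only has to carry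
  -- independent units.
  let e : Module.Basis (Fin (M + 3)) ℤ (𝓞 K × 𝓞 L) :=
    Module.finBasisOfFinrankEq ℤ _ (by
      rw [Module.finrank_prod, RingOfIntegers.rank, RingOfIntegers.rank, hfin, hfin'])
  obtain ⟨h1, h2, h3⟩ := unitsAction_properties e (a := MulEquiv.prodUnits.symm (a, a'))
    (b := MulEquiv.prodUnits.symm (b, b')) (fun k hk y hy => by
      rw [← map_zpow, ← map_zpow, ← map_mul] at hy
      exact Prod.ext
        (eq_zero_of_units_sub_one_mul_eq_zero (hab k hk) (congrArg Prod.fst hy))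
        (eq_zero_of_units_sub_one_mul_eq_zero (hab' k hk) (congrArg Prod.snd hy)))
    (φ := (φ.comp (algebraMap (𝓞 K) K)).comp (RingHom.fst (𝓞 K) (𝓞 L))) ha hb
  exact ⟨_, inferInstance, inferInstance, inferInstance, unitsAction e _ _, h1, h2, h3⟩

theorem theorem3 :
    -- irreducible examples on every torus of even dimension at least six
    (∀ N : ℕ, 6 ≤ N → Even N →
      ∃ (H : Type) (_ : Group H) (_ : Group.FG H) (_ : Group.IsNilpotent H)
        (ρ : H →* Matrix.GeneralLinearGroup (Fin N) ℤ),
        Function.Injective ρ ∧ IsGenuinelyPartiallyHyperbolic ρ ∧ IsHigherRank ρ ∧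
          IsIrreducibleAction ρ) ∧
    -- examples on every torus of odd dimension at least nine, all of them reducible
    (∀ N : ℕ, 9 ≤ N → Odd N →
      (∃ (H : Type) (_ : Group H) (_ : Group.FG H) (_ : Group.IsNilpotent H)
        (ρ : H →* Matrix.GeneralLinearGroup (Fin N) ℤ),
        Function.Injective ρ ∧ IsGenuinelyPartiallyHyperbolic ρ ∧ IsHigherRank ρ) ∧
      ∀ (H : Type u) [Group H] [Group.FG H] [Group.IsNilpotent H]
        (ρ : H →* Matrix.GeneralLinearGroup (Fin N) ℤ),
        IsGenuinelyPartiallyHyperbolic ρ → IsHigherRank ρ → ¬ IsIrreducibleAction ρ) ∧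
    -- no examples in dimension at most five and in dimension seven
    (∀ N : ℕ, N ≤ 5 ∨ N = 7 →
      ∀ (H : Type u) [Group H] [Group.FG H] [Group.IsNilpotent H]
        (ρ : H →* Matrix.GeneralLinearGroup (Fin N) ℤ),
        ¬ (IsGenuinelyPartiallyHyperbolic ρ ∧ IsHigherRank ρ)) :=
  ⟨fun _ hN heven => exists_irreducible_action_of_even hN heven,
    fun _ hN hodd => ⟨exists_action_of_odd hN hodd,
      fun _ _ _ _ ρ hgph hhr => not_isIrreducibleAction_of_odd hodd ρ hgph hhr⟩,
    fun _ hN _ _ _ _ ρ => not_isGenuinelyPartiallyHyperbolic_and_isHigherRank hN ρ⟩
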